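/- Let $|A|$ denote the Lebesgue measure (area) of a measurable set $A\subset\mathbb{R}^2$. For a compact convex set $K\subset\mathbb{R}^2$ with non-empty interior and $z\in\operatorname{int}(K)$, let $K^z=\{y\in\mathbb{R}^2 : \langle y-z,x-z\rangle\le 1 \text{ for all } x\in K\}$ be the polar body of $K$ with center of polarity $z$, and let $\mathcal{P}(K)=\inf\{|K|\,|K^z| : z\in\operatorname{int}(K)\}$ be the volume product of $K$. For $m\ge 3$, let $$P_m=\operatorname{conv}\{(\cos(2k\pi/m),\sin(2k\pi/m)) : k=0,\dots,m-1\}$$ be the regular $m$-gon inscribed in the unit circle. **Theorem.** Let $m\ge 3$. Then $\mathcal{P}(P_m)=\bigl(m\sin(\pi/m)\bigr)^2$. Moreover, let $K\subset\mathbb{R}^2$ be a convex polygon (the convex hull of finitely many points, with non-empty interior) having at most $m$ vertices. Then $$\mathcal{P}(K)\le \mathcal{P}(P_m),$$ with equality if and only if $K$ is an affine image of $P_m$, that is, $K=A(P_m)$ for some bijective affine map $A:\mathbb{R}^2\to\mathbb{R}^2$. -/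

import Mathlib

namespace VolumeProduct

/-- The polar body `K^z` of `K` with center of polarity `z`. -/
def polarBody {n : ℕ} (K : Set (EuclideanSpace ℝ (Fin n))) (z : EuclideanSpace ℝ (Fin n)) :
    Set (EuclideanSpace ℝ (Fin n)) :=
  {y | ∀ x ∈ K, inner ℝ (y - z) (x - z) ≤ 1}

/-- The volume product `𝒫(K) = inf { |K| |K^z| : z ∈ int K }`, where `|·|` is Lebesgue measure.
It takes values in `[0, ∞]`, so that no value has to be assigned by convention. -/
noncomputable def volumeProduct {n : ℕ} (K : Set (EuclideanSpace ℝ (Fin n))) : ENNReal :=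
  ⨅ z ∈ interior K, MeasureTheory.volume K * MeasureTheory.volume (polarBody K z)

/-- `K` is a polytope in `ℝⁿ` (the convex hull of a finite set) with non-empty interior and with at
most `m` vertices; the vertices of a polytope are its extreme points. -/
structure IsPolytopeWithAtMost {n : ℕ} (m : ℕ) (K : Set (EuclideanSpace ℝ (Fin n))) : Prop where
  exists_eq_convexHull : ∃ S : Set (EuclideanSpace ℝ (Fin n)), S.Finite ∧ K = convexHull ℝ S
  interior_nonempty : (interior K).Nonempty
  encard_vertices_le : (K.extremePoints ℝ).encard ≤ m

/-- The regular polygon `P_m` with `m` vertices inscribed in the unit circle: the convex hull of the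
images of the first basis vector `e₁` under the rotations of angles `2kπ/m`, `k = 0, …, m - 1`. -/
noncomputable def regularPolygon (m : ℕ) : Set (EuclideanSpace ℝ (Fin 2)) :=
  convexHull ℝ {v | ∃ k : ℕ, k < m ∧
    v = !₂[Real.cos (2 * (k : ℝ) * Real.pi / (m : ℝ)), Real.sin (2 * (k : ℝ) * Real.pi / (m : ℝ))]}

end VolumeProduct

open MeasureTheory
open scoped ENNReal

/-! Seen from an interior point z, a convex n-gon splits into triangles of double area a_i
(`edgeArea`), with S = ∑ a_i twice the area of K. The polar polygon has double area T(z) = ∑ c_i /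
(a_i a_{i+1}), where c_i is the `corner` determinant. For the upper bound it is enough to find one
good z.

On periodic sequences, regarded as support numbers in the directions p_i - z, the mixed area is a
symmetric form B with B(1, 1) = T. Minkowski's inequality (`mixedArea_self_nonpos`) says B(f, f) ≤ 0
whenever B(1, f) = 0, and equality forces f_i = ⟨ξ, p_i - z⟩
(`exists_eq_inner_of_mixedArea_eq_zero`). The test functions are the coordinates of points on the
unit circle, consecutive ones separated by the angle 2π a_i / S. A topological argument in the style
of Hersch (`exists_balanced`) yields z for which both are B-orthogonal to 1. Adding the two
inequalities gives T ≤ ∑ 4 sin²(π a_i / S) / a_i, that is, ST/4 ≤ π ∑ sin²(α_i) / α_i with α_i = π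
a_i / S and ∑ α_i = π. The tangent line to sin²x / x at π/m bounds this by (m sin(π/m))²
(`sum_sin_sq_div_le`).

Equality forces n = m, equal α_i and linear test functions, so a linear map carries the p_i - z to
the vertices of the regular polygon. For P_m itself, convexity of 1/(ab) bounds the product below at
every center (`le_polarDoubleArea_regularVertex`); affine invariance gives the remaining
implication. -/

namespace VolumeProduct

/-! ### Determinants and triangle areas in the plane. -/

/-- The Euclidean plane. -/
abbrev Plane : Type := EuclideanSpace ℝ (Fin 2)

/-- The determinant of two vectors of the plane. -/
def cross (x y : Plane) : ℝ := x 0 * y 1 - x 1 * y 0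

lemma inner_eq (x y : Plane) : inner ℝ x y = x 0 * y 0 + x 1 * y 1 := by
  simp [PiLp.inner_apply, Fin.sum_univ_two, mul_comm]

lemma plane_ext {x y : Plane} (h0 : x 0 = y 0) (h1 : x 1 = y 1) : x = y := by
  ext i
  fin_cases i
  · exact h0
  · exact h1

/-- The Binet–Cauchy identity in the plane. -/
lemma cross_mul_cross (a b v x : Plane) :
    cross a b * cross v x = inner ℝ a v * inner ℝ b x - inner ℝ a x * inner ℝ b v := by
  simp only [cross, inner_eq]; ring

/-- Cramer's rule in the plane. -/
lemma cross_smul_eq (a b x : Plane) :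
    cross a b • x = cross x b • a + cross a x • b := by
  apply plane_ext <;> simp [cross] <;> ring

lemma eq_combo {a b : Plane} (h : cross a b ≠ 0) (x : Plane) :
    x = (cross x b / cross a b) • a + (cross a x / cross a b) • b := by
  have := cross_smul_eq a b x
  calc x = (cross a b)⁻¹ • (cross a b • x) := by rw [smul_smul, inv_mul_cancel₀ h, one_smul]
    _ = _ := by rw [this, smul_add, smul_smul, smul_smul]; congr 2 <;> ring

lemma integral_one_sub : ∫ x in (0 : ℝ)..1, (1 - x) = 1 / 2 := by
  rw [intervalIntegral.integral_sub (by simp) (by simp)]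
  simp
  norm_num

lemma volume_stdTriangle_open :
    volume {c : Plane | 0 < c 0 ∧ 0 < c 1 ∧ c 0 + c 1 < 1} = ENNReal.ofReal (1 / 2) := by
  have e : MeasurePreserving (fun c : Plane => (c 0, c 1)) volume volume :=
    (volume_preserving_finTwoArrow ℝ).comp
      (EuclideanSpace.volume_preserving_symm_measurableEquiv_toLp (Fin 2))
  have hT : {c : Plane | 0 < c 0 ∧ 0 < c 1 ∧ c 0 + c 1 < 1} =
      (fun c : Plane => (c 0, c 1)) ⁻¹'
        (regionBetween (fun _ => (0 : ℝ)) (fun x => 1 - x) (Set.Ioc 0 1)) := by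
    ext c
    simp only [regionBetween, Set.mem_ofPred_eq, Set.mem_preimage, Set.mem_Ioc, Set.mem_Ioo]
    constructor
    · rintro ⟨h0, h1, h2⟩; exact ⟨⟨h0, by linarith⟩, h1, by linarith⟩
    · rintro ⟨⟨h0, _⟩, h1, h2⟩; exact ⟨h0, h1, by linarith⟩
  have hm : MeasurableSet (regionBetween (fun _ => (0 : ℝ)) (fun x => 1 - x) (Set.Ioc 0 1)) :=
    measurableSet_regionBetween measurable_const (by fun_prop) measurableSet_Ioc
  rw [hT, e.measure_preimage hm.nullMeasurableSet]
  rw [Measure.volume_eq_prod, volume_regionBetween_eq_integral]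
  · congr 1
    simp only [Pi.sub_apply, sub_zero]
    rw [← intervalIntegral.integral_of_le zero_le_one]
    exact integral_one_sub
  · exact (continuous_const.integrableOn_Icc).mono_set Set.Ioc_subset_Icc_self
  · exact (Continuous.integrableOn_Icc (by fun_prop)).mono_set Set.Ioc_subset_Icc_self
  · exact measurableSet_Ioc
  · intro x hx; simp only [Set.mem_Ioc] at hx; linarith

/-- An upper bound suffices here: closed triangles serve to cover a polygon, open ones to pack it.
-/
lemma volume_stdTriangle_closed_le :
    volume {c : Plane | 0 ≤ c 0 ∧ 0 ≤ c 1 ∧ c 0 + c 1 ≤ 1} ≤ ENNReal.ofReal (1 / 2) := by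
  have e : MeasurePreserving (fun c : Plane => (c 0, c 1)) volume volume :=
    (volume_preserving_finTwoArrow ℝ).comp
      (EuclideanSpace.volume_preserving_symm_measurableEquiv_toLp (Fin 2))
  set T : Set (ℝ × ℝ) := {q | 0 ≤ q.1 ∧ 0 ≤ q.2 ∧ q.1 + q.2 ≤ 1}
  have hm : MeasurableSet T := by
    apply IsClosed.measurableSet
    exact (isClosed_le continuous_const continuous_fst).inter
      ((isClosed_le continuous_const continuous_snd).inter
        (isClosed_le (continuous_fst.add continuous_snd) continuous_const))
  have hT : {c : Plane | 0 ≤ c 0 ∧ 0 ≤ c 1 ∧ c 0 + c 1 ≤ 1} =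
      (fun c : Plane => (c 0, c 1)) ⁻¹' T := rfl
  rw [hT, e.measure_preimage hm.nullMeasurableSet, Measure.volume_eq_prod,
    Measure.prod_apply hm]
  have hle : ∀ x : ℝ, volume (Prod.mk x ⁻¹' T) ≤
      (Set.Icc (0 : ℝ) 1).indicator (fun x => ENNReal.ofReal (1 - x)) x := by
    intro x
    by_cases hx : x ∈ Set.Icc (0 : ℝ) 1
    · rw [Set.indicator_of_mem hx]
      calc volume (Prod.mk x ⁻¹' T) ≤ volume (Set.Icc (0 : ℝ) (1 - x)) := by
            apply measure_mono
            rintro y ⟨_, h1, h2⟩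
            simp only at h1 h2
            exact ⟨h1, by linarith⟩
        _ = _ := by rw [Real.volume_Icc, sub_zero]
    · have : Prod.mk x ⁻¹' T = ∅ := by
        ext y
        simp only [Set.mem_preimage, Set.mem_empty_iff_false, iff_false]
        rintro ⟨h0, h1, h2⟩
        simp only at h0 h1 h2
        exact hx ⟨h0, by linarith⟩
      rw [this]; simp
  refine (lintegral_mono hle).trans ?_
  rw [lintegral_indicator measurableSet_Icc, ← ofReal_integral_eq_lintegral_ofReal]
  · rw [integral_Icc_eq_integral_Ioc, ← intervalIntegral.integral_of_le zero_le_one]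
    exact ENNReal.ofReal_le_ofReal integral_one_sub.le
  · exact Continuous.integrableOn_Icc (by fun_prop)
  · filter_upwards [self_mem_ae_restrict measurableSet_Icc] with x hx
    simp only [Pi.zero_apply]; linarith [hx.2]

/-- The linear map sending the standard basis to `a, b`. -/
noncomputable def frame (a b : Plane) : Plane →ₗ[ℝ] Plane where
  toFun c := c 0 • a + c 1 • b
  map_add' x y := by simp only [PiLp.add_apply, add_smul]; abel
  map_smul' r x := by simp [smul_smul]

lemma frame_apply (a b c : Plane) : frame a b c = c 0 • a + c 1 • b := rfl

lemma det_frame (a b : Plane) : LinearMap.det (frame a b) = cross a b := by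
  rw [← LinearMap.det_toMatrix (EuclideanSpace.basisFun (Fin 2) ℝ).toBasis, Matrix.det_fin_two]
  simp [LinearMap.toMatrix_apply, frame_apply, cross]
  ring

lemma volume_openTriangle {a b : Plane} (h : 0 < cross a b) :
    volume (frame a b '' {c : Plane | 0 < c 0 ∧ 0 < c 1 ∧ c 0 + c 1 < 1}) =
      ENNReal.ofReal (cross a b / 2) := by
  rw [Measure.addHaar_image_linearMap, det_frame, volume_stdTriangle_open, abs_of_pos h,
    ← ENNReal.ofReal_mul h.le]
  congr 1; ring

lemma volume_closedTriangle_le {a b : Plane} (h : 0 < cross a b) :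
    volume (frame a b '' {c : Plane | 0 ≤ c 0 ∧ 0 ≤ c 1 ∧ c 0 + c 1 ≤ 1}) ≤
      ENNReal.ofReal (cross a b / 2) := by
  rw [Measure.addHaar_image_linearMap, det_frame, abs_of_pos h]
  calc _ ≤ ENNReal.ofReal (cross a b) * ENNReal.ofReal (1 / 2) := by
        gcongr; exact volume_stdTriangle_closed_le
    _ = _ := by rw [← ENNReal.ofReal_mul h.le]; congr 1; ring

lemma measurableSet_openTriangle {a b : Plane} (h : 0 < cross a b) :
    MeasurableSet (frame a b '' {c : Plane | 0 < c 0 ∧ 0 < c 1 ∧ c 0 + c 1 < 1}) := by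
  have hs : frame a b '' {c : Plane | 0 < c 0 ∧ 0 < c 1 ∧ c 0 + c 1 < 1} =
      {x | 0 < cross x b / cross a b ∧ 0 < cross a x / cross a b ∧
        cross x b / cross a b + cross a x / cross a b < 1} := by
    ext x
    constructor
    · rintro ⟨c, ⟨h0, h1, h2⟩, rfl⟩
      have e0 : cross (frame a b c) b = c 0 * cross a b := by simp [frame_apply, cross]; ring
      have e1 : cross a (frame a b c) = c 1 * cross a b := by simp [frame_apply, cross]; ring
      simp only [Set.mem_ofPred_eq, e0, e1, mul_div_cancel_right₀ _ h.ne']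
      exact ⟨h0, h1, h2⟩
    · rintro ⟨h0, h1, h2⟩
      refine ⟨!₂[cross x b / cross a b, cross a x / cross a b], ?_, ?_⟩
      · simpa using ⟨h0, h1, h2⟩
      · conv_rhs => rw [eq_combo h.ne' x]
        simp [frame_apply]
  rw [hs]
  have h1 : Continuous fun x : Plane => cross x b / cross a b := by unfold cross; fun_prop
  have h2 : Continuous fun x : Plane => cross a x / cross a b := by unfold cross; fun_prop
  exact ((isOpen_lt continuous_const h1).inter ((isOpen_lt continuous_const h2).inter
    (isOpen_lt (h1.add h2) continuous_const))).measurableSet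

end VolumeProduct

/-! ### Areas from a pair of dual fans. -/

namespace VolumeProduct

/-- Two closed `n`-periodic sequences, each turning counterclockwise, such that `w i` is dual to the
edge from `v i` to `v (i + 1)`. -/
structure DualFan (n : ℕ) (v w : ℕ → Plane) : Prop where
  pos : 0 < n
  periodic_left : Function.Periodic v n
  periodic_right : Function.Periodic w n
  inner_self : ∀ i, inner ℝ (w i) (v i) = 1
  inner_succ : ∀ i, inner ℝ (w i) (v (i + 1)) = 1
  cross_left : ∀ i, 0 < cross (v i) (v (i + 1))
  cross_right : ∀ i, 0 < cross (w i) (w (i + 1))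

namespace DualFan

variable {n : ℕ} {v w : ℕ → Plane}

/-- Duality lets one area argument serve both the polygon and its polar. The index shifts because `w
i` and `w (i + 1)` both pair to 1 with `v (i + 1)`. -/
lemma swap (h : DualFan n v w) : DualFan n w (fun i => v (i + 1)) where
  pos := h.pos
  periodic_left := h.periodic_right
  periodic_right i := by
    simp only []
    rw [show i + n + 1 = i + 1 + n by ring, h.periodic_left]
  inner_self i := by rw [real_inner_comm]; exact h.inner_succ i
  inner_succ i := by rw [real_inner_comm]; exact h.inner_self (i + 1)
  cross_left := h.cross_right
  cross_right i := h.cross_left (i + 1)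

/-- The side of the ray through `v (i + 1)` on which `x` lies is thus the sign of the increment of
`i ↦ ⟨w i, x⟩`; a maximizing index locates the cone containing `x`. -/
lemma inner_sub_eq (h : DualFan n v w) (i : ℕ) (x : Plane) :
    cross (w i) (w (i + 1)) * cross (v (i + 1)) x = inner ℝ (w (i + 1)) x - inner ℝ (w i) x := by
  rw [cross_mul_cross, h.inner_succ, h.inner_self]; ring

/-- The cones spanned by consecutive vectors of a fan cover the plane. -/
lemma exists_mem_cone (h : DualFan n v w) (x : Plane) :
    ∃ i < n, ∃ s t : ℝ, 0 ≤ s ∧ 0 ≤ t ∧ x = s • v i + t • v (i + 1) := by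
  obtain ⟨i, hi, hmax⟩ := Finset.exists_max_image (Finset.range n)
    (fun i => inner ℝ (w i) x) ⟨0, by simpa using h.pos⟩
  rw [Finset.mem_range] at hi
  have hmax' : ∀ k, inner ℝ (w k) x ≤ inner ℝ (w i) x := fun k => by
    rw [← h.periodic_right.map_mod_nat k]
    exact hmax _ (Finset.mem_range.2 (Nat.mod_lt _ h.pos))
  have h1 : cross (v (i + 1)) x ≤ 0 := by
    have := h.inner_sub_eq i x
    have := hmax' (i + 1)
    by_contra hc
    have := mul_pos (h.cross_right i) (not_le.1 hc)
    linarith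
  have h2 : 0 ≤ cross (v i) x := by
    obtain ⟨k, hk⟩ : ∃ k, k + 1 = i + n := ⟨i + n - 1, by have := h.pos; omega⟩
    have e := h.inner_sub_eq k x
    rw [hk, h.periodic_left, h.periodic_right] at e
    have := hmax' k
    by_contra hc
    have hw := h.cross_right k
    rw [hk, h.periodic_right] at hw
    have := mul_neg_of_pos_of_neg hw (not_le.1 hc)
    linarith
  have hv := h.cross_left i
  refine ⟨i, hi, _, _, ?_, ?_, eq_combo hv.ne' x⟩
  · have : cross x (v (i + 1)) = - cross (v (i + 1)) x := by unfold cross; ring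
    rw [this]; apply div_nonneg _ hv.le; linarith
  · exact div_nonneg h2 hv.le

lemma inner_combo (h : DualFan n v w) (i : ℕ) (s t : ℝ) :
    inner ℝ (w i) (s • v i + t • v (i + 1)) = s + t := by
  rw [inner_add_right, inner_smul_right, inner_smul_right, h.inner_self, h.inner_succ]; ring

/-- In the i-th cone the coordinates of `x` add up to `⟨w i, x⟩ ≤ 1`, so the closed triangles cover
`X`. -/
lemma volume_le (h : DualFan n v w) {X : Set Plane}
    (hX : ∀ x ∈ X, ∀ i, inner ℝ (w i) x ≤ 1) :
    volume X ≤ ENNReal.ofReal ((∑ i ∈ Finset.range n, cross (v i) (v (i + 1))) / 2) := by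
  calc volume X ≤ volume (⋃ i ∈ Finset.range n, frame (v i) (v (i + 1)) ''
          {c : Plane | 0 ≤ c 0 ∧ 0 ≤ c 1 ∧ c 0 + c 1 ≤ 1}) := by
        apply measure_mono
        intro x hx
        obtain ⟨i, hi, s, t, hs, ht, e⟩ := h.exists_mem_cone x
        have h1 := hX x hx i
        rw [e, h.inner_combo] at h1
        simp only [Set.mem_iUnion]
        refine ⟨i, Finset.mem_range.2 hi, !₂[s, t], ?_, ?_⟩
        · simpa using ⟨hs, ht, h1⟩
        · simp [frame_apply, e]
    _ ≤ ∑ i ∈ Finset.range n, volume (frame (v i) (v (i + 1)) ''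
          {c : Plane | 0 ≤ c 0 ∧ 0 ≤ c 1 ∧ c 0 + c 1 ≤ 1}) := measure_biUnion_finset_le _ _
    _ ≤ ∑ i ∈ Finset.range n, ENNReal.ofReal (cross (v i) (v (i + 1)) / 2) :=
        Finset.sum_le_sum fun i _ => volume_closedTriangle_le (h.cross_left i)
    _ = _ := by
        rw [← ENNReal.ofReal_sum_of_nonneg, Finset.sum_div]
        intro i _
        have := h.cross_left i
        positivity

/-- The open triangles are disjoint because `w j` is strictly the largest functional on the j-th
one. This is where `hlt` excludes overlaps from winding around more than once. -/
lemma le_volume (h : DualFan n v w) {X : Set Plane} (hX : Convex ℝ X) (h0 : 0 ∈ X)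
    (hv : ∀ i, v i ∈ X) (hle : ∀ i j, inner ℝ (w i) (v j) ≤ 1)
    (hlt : ∀ i < n, ∀ j < n, i ≠ j →
      inner ℝ (w i) (v j) < 1 ∨ inner ℝ (w i) (v (j + 1)) < 1) :
    ENNReal.ofReal ((∑ i ∈ Finset.range n, cross (v i) (v (i + 1))) / 2) ≤ volume X := by
  set T : ℕ → Set Plane := fun i => frame (v i) (v (i + 1)) ''
          {c : Plane | 0 < c 0 ∧ 0 < c 1 ∧ c 0 + c 1 < 1}
  have key : ∀ i < n, ∀ j < n, i ≠ j → ∀ x ∈ T j, inner ℝ (w i) x < inner ℝ (w j) x := by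
    rintro i hi j hj hij _ ⟨c, ⟨h0, h1, -⟩, rfl⟩
    rw [frame_apply, h.inner_combo, inner_add_right, inner_smul_right, inner_smul_right]
    have l0 := hle i j
    have l1 := hle i (j + 1)
    rcases hlt i hi j hj hij with h' | h'
    · nlinarith
    · nlinarith
  have hdisj : Set.PairwiseDisjoint (Finset.range n : Set ℕ) T := by
    intro i hi j hj hij
    simp only [Finset.coe_range, Set.mem_Iio] at hi hj
    refine Set.disjoint_left.2 fun x hxi hxj => ?_
    exact lt_asymm (key i hi j hj hij x hxj) (key j hj i hi hij.symm x hxi)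
  calc _ = ∑ i ∈ Finset.range n, ENNReal.ofReal (cross (v i) (v (i + 1)) / 2) := by
        rw [← ENNReal.ofReal_sum_of_nonneg, Finset.sum_div]
        intro i _
        have := h.cross_left i
        positivity
    _ = ∑ i ∈ Finset.range n, volume (T i) :=
        Finset.sum_congr rfl fun i _ => (volume_openTriangle (h.cross_left i)).symm
    _ = volume (⋃ i ∈ Finset.range n, T i) :=
        (measure_biUnion_finset hdisj fun i _ => measurableSet_openTriangle (h.cross_left i)).symm
    _ ≤ volume X := by
        apply measure_mono
        simp only [Set.iUnion_subset_iff]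
        rintro i - _ ⟨c, ⟨c0, c1, c2⟩, rfl⟩
        rw [frame_apply]
        have := hX.sum_mem (t := Finset.univ) (w := ![1 - c 0 - c 1, c 0, c 1])
          (z := ![0, v i, v (i + 1)])
          (by intro k _; fin_cases k <;> simp <;> linarith)
          (by simp [Fin.sum_univ_three]; ring) (by intro k _; fin_cases k <;> simp [h0, hv])
        simpa [Fin.sum_univ_three] using this

end DualFan

/-! ### Convex polygons and their polar polygons. -/

/-- `p` enumerates, counterclockwise and with period `n`, the vertices of a convex `n`-gon. -/
structure ConvexPolygon (n : ℕ) (p : ℕ → Plane) : Prop where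
  periodic : Function.Periodic p n
  three_le : 3 ≤ n
  cross_pos : ∀ i j, i + 1 < j → j < i + n → 0 < cross (p (i + 1) - p i) (p j - p i)

lemma sum_range_shift {n : ℕ} {f : ℕ → ℝ} (hf : Function.Periodic f n) :
    ∑ i ∈ Finset.range n, f (i + 1) = ∑ i ∈ Finset.range n, f i := by
  have h := Finset.sum_range_succ' f n
  rw [Finset.sum_range_succ, ← zero_add n, hf 0, zero_add] at h
  linarith

/-- The determinant of the `i`-th edge as seen from `z`; twice the signed area of a triangle. -/
def edgeArea (p : ℕ → Plane) (z : Plane) (i : ℕ) : ℝ := cross (p i - z) (p (i + 1) - z)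

/-- The determinant of the edges of a polygon at the vertex `i + 1`. -/
def corner (p : ℕ → Plane) (i : ℕ) : ℝ := cross (p (i + 1) - p i) (p (i + 2) - p (i + 1))

/-- The vertices of the polar polygon of `p` with respect to `z`. -/
noncomputable def dualVertex (p : ℕ → Plane) (z : Plane) (i : ℕ) : Plane :=
  (edgeArea p z i)⁻¹ • !₂[(p (i + 1) - p i) 1, -(p (i + 1) - p i) 0]

lemma inner_dualVertex (p : ℕ → Plane) (z x : Plane) (i : ℕ) :
    inner ℝ (dualVertex p z i) x = cross x (p (i + 1) - p i) / edgeArea p z i := by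
  rw [inner_eq]; simp [dualVertex, cross]; ring

lemma cross_dualVertex (p : ℕ → Plane) (z : Plane) (i : ℕ) :
    cross (dualVertex p z i) (dualVertex p z (i + 1)) =
      corner p i / (edgeArea p z i * edgeArea p z (i + 1)) := by
  simp [dualVertex, cross, corner]; ring

lemma edgeArea_eq (p : ℕ → Plane) (z : Plane) (i : ℕ) :
    edgeArea p z i = cross (p (i + 1) - p i) (z - p i) := by
  simp [edgeArea, cross]; ring

lemma edgeArea_vertex (p : ℕ → Plane) (i j : ℕ) :
    edgeArea p (p j) i = cross (p (i + 1) - p i) (p j - p i) := edgeArea_eq p _ i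

lemma edgeArea_combo (p : ℕ → Plane) (x y : Plane) {s t : ℝ} (h : s + t = 1) (i : ℕ) :
    edgeArea p (s • x + t • y) i = s * edgeArea p x i + t * edgeArea p y i := by
  obtain rfl : t = 1 - s := by linarith
  simp [edgeArea, cross]; ring

lemma continuous_edgeArea (p : ℕ → Plane) (i : ℕ) : Continuous fun z => edgeArea p z i := by
  unfold edgeArea cross
  simp only [PiLp.sub_apply]
  fun_prop

namespace ConvexPolygon

variable {n : ℕ} {p : ℕ → Plane} {z : Plane}

lemma pos (h : ConvexPolygon n p) : 0 < n := by have := h.three_le; omega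

lemma periodic_edgeArea (h : ConvexPolygon n p) (z : Plane) :
    Function.Periodic (edgeArea p z) n := fun i => by
  unfold edgeArea
  rw [show i + n + 1 = i + 1 + n by ring, h.periodic, h.periodic]

/-- Moves any index into the window `[i, i + n)` in which `cross_pos` can be applied. -/
lemma exists_shift (h : ConvexPolygon n p) (i j : ℕ) :
    ∃ k, i ≤ k ∧ k < i + n ∧ k % n = j % n ∧ p k = p j := by
  have hn := h.pos
  have key : (i + (j + (n - i % n)) % n) % n = j % n := by
    have hi := Nat.mod_lt i hn
    have hd := Nat.div_add_mod i n
    rw [Nat.add_mod_mod, show i + (j + (n - i % n)) = j + n + n * (i / n) by omega,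
      Nat.add_mul_mod_self_left, Nat.add_mod_right]
  have hlt := Nat.mod_lt (j + (n - i % n)) hn
  refine ⟨i + (j + (n - i % n)) % n, by omega, by omega, key, ?_⟩
  rw [← h.periodic.map_mod_nat, ← h.periodic.map_mod_nat j, key]

lemma edgeArea_vertex_pos (h : ConvexPolygon n p) {i j : ℕ} (h1 : i + 1 < j) (h2 : j < i + n) :
    0 < edgeArea p (p j) i := by
  rw [edgeArea_vertex]; exact h.cross_pos i j h1 h2

lemma edgeArea_self (p : ℕ → Plane) (i : ℕ) : edgeArea p (p i) i = 0 := by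
  simp [edgeArea, cross]

lemma edgeArea_succ (p : ℕ → Plane) (i : ℕ) : edgeArea p (p (i + 1)) i = 0 := by
  simp [edgeArea, cross]

lemma edgeArea_vertex_nonneg (h : ConvexPolygon n p) (i j : ℕ) : 0 ≤ edgeArea p (p j) i := by
  obtain ⟨k, h1, h2, -, h3⟩ := h.exists_shift i j
  rw [← h3]
  rcases h1.eq_or_lt with rfl | h1
  · rw [edgeArea_self]
  rcases (Nat.succ_le_of_lt h1).eq_or_lt with rfl | h1
  · rw [Nat.succ_eq_add_one, edgeArea_succ]
  · exact (h.edgeArea_vertex_pos h1 h2).le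

lemma corner_pos (h : ConvexPolygon n p) (i : ℕ) : 0 < corner p i := by
  have := h.cross_pos i (i + 2) (by omega) (by have := h.three_le; omega)
  calc 0 < _ := this
    _ = _ := by simp [corner, cross]; ring

lemma dualFan (h : ConvexPolygon n p) (hz : ∀ i, 0 < edgeArea p z i) :
    DualFan n (fun i => p i - z) (dualVertex p z) where
  pos := h.pos
  periodic_left i := by simp only [h.periodic i]
  periodic_right i := by
    unfold dualVertex
    rw [h.periodic_edgeArea, h.periodic, show i + n + 1 = i + 1 + n by ring, h.periodic]
  inner_self i := by
    rw [inner_dualVertex, div_eq_one_iff_eq (hz i).ne']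
    simp [edgeArea, cross]; ring
  inner_succ i := by
    rw [inner_dualVertex, div_eq_one_iff_eq (hz i).ne']
    simp [edgeArea, cross]; ring
  cross_left := hz
  cross_right i := by
    rw [cross_dualVertex]
    exact div_pos (h.corner_pos i) (mul_pos (hz i) (hz _))

/-- Translates polarity into signs of `edgeArea`, an affine function of the center that vanishes on
the line of the i-th edge. -/
lemma inner_dualVertex_eq (hz : ∀ i, 0 < edgeArea p z i) (i : ℕ) (x : Plane) :
    inner ℝ (dualVertex p z i) (x - z) = 1 - edgeArea p x i / edgeArea p z i := by
  rw [inner_dualVertex, eq_sub_iff_add_eq, ← add_div, div_eq_one_iff_eq (hz i).ne']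
  simp [edgeArea, cross]; ring

lemma inner_dualVertex_le (h : ConvexPolygon n p) (hz : ∀ i, 0 < edgeArea p z i) (i j : ℕ) :
    inner ℝ (dualVertex p z i) (p j - z) ≤ 1 := by
  rw [inner_dualVertex_eq hz]
  have := div_nonneg (h.edgeArea_vertex_nonneg i j) (hz i).le
  linarith

lemma inner_dualVertex_lt (h : ConvexPolygon n p) (hz : ∀ i, 0 < edgeArea p z i) {i j : ℕ}
    (h1 : i + 1 < j) (h2 : j < i + n) :
    inner ℝ (dualVertex p z i) (p j - z) < 1 := by
  rw [inner_dualVertex_eq hz]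
  have := div_pos (h.edgeArea_vertex_pos h1 h2) (hz i)
  linarith

end ConvexPolygon
end VolumeProduct

/-! ### Areas of a polygon and of its polar body. -/

namespace VolumeProduct

/-- Twice the area enclosed by a closed polygon. -/
def doubleArea (n : ℕ) (p : ℕ → Plane) : ℝ := ∑ i ∈ Finset.range n, cross (p i) (p (i + 1))

/-- Twice the area of the polar polygon with respect to `z`. -/
noncomputable def polarDoubleArea (n : ℕ) (p : ℕ → Plane) (z : Plane) : ℝ :=
  ∑ i ∈ Finset.range n, corner p i / (edgeArea p z i * edgeArea p z (i + 1))

lemma convex_polarBody (K : Set Plane) (z : Plane) : Convex ℝ (polarBody K z) := by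
  intro x hx y hy s t hs ht hst k hk
  have h1 := hx k hk
  have h2 := hy k hk
  have : s • x + t • y - z = s • (x - z) + t • (y - z) := by
    obtain rfl : t = 1 - s := by linarith
    module
  rw [this, inner_add_left, real_inner_smul_left, real_inner_smul_left]
  nlinarith

lemma mem_polarBody_convexHull {S : Set Plane} {y z : Plane} :
    y ∈ polarBody (convexHull ℝ S) z ↔ ∀ x ∈ S, inner ℝ (y - z) (x - z) ≤ 1 := by
  refine ⟨fun h x hx => h x (subset_convexHull ℝ S hx), fun h => ?_⟩
  have hc : Convex ℝ {x : Plane | inner ℝ (y - z) (x - z) ≤ 1} := by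
    intro a ha b hb s t hs ht hst
    have : s • a + t • b - z = s • (a - z) + t • (b - z) := by
      obtain rfl : t = 1 - s := by linarith
      module
    simp only [Set.mem_ofPred_eq] at *
    rw [this, inner_add_right, real_inner_smul_right, real_inner_smul_right]
    nlinarith
  exact fun x hx => convexHull_min h hc hx

lemma volume_image_sub (X : Set Plane) (z : Plane) :
    volume ((fun x => x - z) '' X) = volume X := by
  simp_rw [sub_eq_add_neg]
  rw [Set.image_add_right]
  exact measure_preimage_add_right _ _ _

namespace ConvexPolygon

variable {n : ℕ} {p : ℕ → Plane} {z : Plane}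

/-- The terms involving `z` telescope around the polygon. -/
lemma sum_edgeArea (h : ConvexPolygon n p) (z : Plane) :
    ∑ i ∈ Finset.range n, edgeArea p z i = doubleArea n p := by
  have hs := sum_range_shift (f := fun i => cross z (p i)) (n := n)
    (fun i => by simp only [h.periodic i])
  have : ∀ i, edgeArea p z i = cross (p i) (p (i + 1)) + cross z (p i) - cross z (p (i + 1)) := by
    intro i; simp [edgeArea, cross]; ring
  simp only [this, Finset.sum_sub_distrib, Finset.sum_add_distrib, doubleArea]
  linarith

lemma convex_edgeArea_nonneg (p : ℕ → Plane) (i : ℕ) : Convex ℝ {z | 0 ≤ edgeArea p z i} := by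
  intro x hx y hy s t hs ht hst
  simp only [Set.mem_ofPred_eq] at *
  rw [edgeArea_combo p x y hst]
  positivity

lemma edgeArea_nonneg (h : ConvexPolygon n p) (hz : z ∈ convexHull ℝ (Set.range p)) (i : ℕ) :
    0 ≤ edgeArea p z i := by
  refine convexHull_min ?_ (convex_edgeArea_nonneg p i) hz
  rintro _ ⟨j, rfl⟩
  exact h.edgeArea_vertex_nonneg i j

/-- The vector opposite to `p 0 - z` lies in the cone of some edge; this writes `z` as a convex
combination of `p 0`, `p i` and `p (i + 1)`. -/
lemma mem_convexHull (h : ConvexPolygon n p) (hz : ∀ i, 0 < edgeArea p z i) :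
    z ∈ convexHull ℝ (Set.range p) := by
  obtain ⟨i, -, s, t, hs, ht, e⟩ := (h.dualFan hz).exists_mem_cone (-(p 0 - z))
  have hc := convex_convexHull ℝ (Set.range p)
  have := hc.sum_mem (t := Finset.univ)
    (w := ![1 / (1 + s + t), s / (1 + s + t), t / (1 + s + t)])
    (z := ![p 0, p i, p (i + 1)])
    (by intro k _; fin_cases k <;> simp <;> positivity)
    (by
      have : 1 + s + t ≠ 0 := by positivity
      simp [Fin.sum_univ_three]; field_simp)
    (by intro k _; fin_cases k <;> exact subset_convexHull ℝ _ ⟨_, rfl⟩)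
  convert this using 1
  have hne : 1 + s + t ≠ 0 := by positivity
  have e' : (1 + s + t) • z = p 0 + s • p i + t • p (i + 1) := by
    have e2 : s • (p i - z) + t • (p (i + 1) - z) + (p 0 - z) = 0 := by rw [← e]; abel
    rw [← sub_eq_zero, ← neg_eq_zero, ← e2]
    module
  calc z = (1 + s + t)⁻¹ • ((1 + s + t) • z) := by rw [smul_smul, inv_mul_cancel₀ hne, one_smul]
    _ = _ := by
      rw [e']
      simp [Fin.sum_univ_three, smul_smul, div_eq_inv_mul]

lemma edgeArea_pos_iff (h : ConvexPolygon n p) :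
    (∀ i, 0 < edgeArea p z i) ↔ ∀ i ∈ Finset.range n, 0 < edgeArea p z i := by
  refine ⟨fun H i _ => H i, fun H i => ?_⟩
  rw [← (h.periodic_edgeArea z).map_mod_nat i]
  exact H _ (Finset.mem_range.2 (Nat.mod_lt _ h.pos))

lemma mem_interior (h : ConvexPolygon n p) (hz : ∀ i, 0 < edgeArea p z i) :
    z ∈ interior (convexHull ℝ (Set.range p)) := by
  rw [_root_.mem_interior]
  refine ⟨⋂ i ∈ Finset.range n, {z | 0 < edgeArea p z i}, ?_, ?_, ?_⟩
  · intro x hx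
    simp only [Set.mem_iInter] at hx
    exact h.mem_convexHull (h.edgeArea_pos_iff.2 hx)
  · exact isOpen_biInter_finset fun i _ => isOpen_lt continuous_const (continuous_edgeArea p i)
  · simp only [Set.mem_iInter]
    exact fun i _ => hz i

/-- An affine function that is nonnegative on a set and not constant is positive in its interior. -/
lemma _root_.VolumeProduct.cross_pos_of_mem_interior {K : Set Plane} {a b z : Plane} (hb : b ≠ 0)
    (hK : ∀ x ∈ K, 0 ≤ cross b (x - a)) (hz : z ∈ interior K) : 0 < cross b (z - a) := by
  -- `cross b` decreases in the direction `(b 1, -b 0)`; a small step that way stays in `K`.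
  have hcont : Filter.Tendsto (fun t : ℝ => z + t • !₂[b 1, -b 0]) (nhds 0) (nhds z) := by
    have : Continuous (fun t : ℝ => z + t • !₂[b 1, -b 0]) := by fun_prop
    simpa using this.tendsto 0
  have hev := hcont.eventually (mem_interior_iff_mem_nhds.1 hz)
  obtain ⟨ε, hε, hball⟩ := Metric.eventually_nhds_iff.1 hev
  have := hK _ (hball (y := ε / 2) (by simp [abs_of_pos hε]; linarith))
  have hpos : 0 < b 0 ^ 2 + b 1 ^ 2 := by
    by_contra hc
    apply hb
    have h0 := sq_nonneg (b 0)
    have h1 := sq_nonneg (b 1)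
    apply plane_ext
    · exact pow_eq_zero_iff (n := 2) (by norm_num) |>.1 (by linarith)
    · exact pow_eq_zero_iff (n := 2) (by norm_num) |>.1 (by linarith)
  have e : cross b (z + (ε / 2) • !₂[b 1, -b 0] - a) =
      cross b (z - a) - ε / 2 * (b 0 ^ 2 + b 1 ^ 2) := by
    simp [cross]; ring
  rw [e] at this
  have := mul_pos (half_pos hε) hpos
  linarith

lemma edge_ne_zero (h : ConvexPolygon n p) (i : ℕ) : p (i + 1) - p i ≠ 0 := by
  intro e
  have := h.corner_pos i
  unfold corner at this
  rw [e] at this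
  simp [cross] at this

lemma edgeArea_pos_of_mem_interior (h : ConvexPolygon n p)
    (hz : z ∈ interior (convexHull ℝ (Set.range p))) (i : ℕ) : 0 < edgeArea p z i := by
  rw [edgeArea_eq]
  refine cross_pos_of_mem_interior (h.edge_ne_zero i) (fun x hx => ?_) hz
  rw [← edgeArea_eq]
  exact h.edgeArea_nonneg hx i

/-- The open half-plane of the edge together with the edge itself is convex and contains every
vertex. -/
lemma mem_segment (h : ConvexPolygon n p) (hz : z ∈ convexHull ℝ (Set.range p)) {i : ℕ}
    (hi : edgeArea p z i = 0) : z ∈ segment ℝ (p i) (p (i + 1)) := by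
  have hc : Convex ℝ {x | 0 < edgeArea p x i ∨
      (edgeArea p x i = 0 ∧ x ∈ segment ℝ (p i) (p (i + 1)))} := by
    refine convex_iff_forall_pos.2 fun x hx y hy s t hs ht hst => ?_
    simp only [Set.mem_ofPred_eq] at *
    rw [edgeArea_combo p x y hst]
    rcases hx with hx | ⟨hx, hx'⟩ <;> rcases hy with hy | ⟨hy, hy'⟩
    · left; positivity
    · left; rw [hy]; simp; positivity
    · left; rw [hx]; simp; positivity
    · right
      exact ⟨by rw [hx, hy]; simp, convex_segment _ _ hx' hy' hs.le ht.le hst⟩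
  have := convexHull_min (s := Set.range p) ?_ hc hz
  · rcases this with h' | h'
    · exact absurd hi h'.ne'
    · exact h'.2
  rintro _ ⟨j, rfl⟩
  obtain ⟨k, h1, h2, -, h3⟩ := h.exists_shift i j
  rw [← h3]
  rcases h1.eq_or_lt with rfl | h1
  · exact Or.inr ⟨edgeArea_self p _, left_mem_segment ℝ _ _⟩
  rcases (Nat.succ_le_of_lt h1).eq_or_lt with rfl | h1
  · exact Or.inr ⟨edgeArea_succ p _, right_mem_segment ℝ _ _⟩
  · exact Or.inl (h.edgeArea_vertex_pos h1 h2)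

lemma volume_hull_le (h : ConvexPolygon n p) (hz : ∀ i, 0 < edgeArea p z i) :
    volume (convexHull ℝ (Set.range p)) ≤ ENNReal.ofReal (doubleArea n p / 2) := by
  rw [← volume_image_sub _ z, ← h.sum_edgeArea z]
  apply (h.dualFan hz).volume_le
  rintro _ ⟨x, hx, rfl⟩ i
  rw [inner_dualVertex_eq hz]
  have := div_nonneg (h.edgeArea_nonneg hx i) (hz i).le
  linarith

lemma sum_cross_dualVertex (p : ℕ → Plane) (z : Plane) (n : ℕ) :
    ∑ i ∈ Finset.range n, cross (dualVertex p z i) (dualVertex p z (i + 1)) =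
      polarDoubleArea n p z :=
  Finset.sum_congr rfl fun i _ => cross_dualVertex p z i

lemma volume_polar_le (h : ConvexPolygon n p) (hz : ∀ i, 0 < edgeArea p z i) :
    volume (polarBody (convexHull ℝ (Set.range p)) z) ≤
      ENNReal.ofReal (polarDoubleArea n p z / 2) := by
  rw [← volume_image_sub _ z, ← sum_cross_dualVertex]
  apply (h.dualFan hz).swap.volume_le
  rintro _ ⟨x, hx, rfl⟩ i
  rw [real_inner_comm]
  exact hx _ (subset_convexHull ℝ _ ⟨_, rfl⟩)

lemma le_volume_hull (h : ConvexPolygon n p) (hz : ∀ i, 0 < edgeArea p z i) :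
    ENNReal.ofReal (doubleArea n p / 2) ≤ volume (convexHull ℝ (Set.range p)) := by
  rw [← volume_image_sub _ z, ← h.sum_edgeArea z]
  have h3 := h.three_le
  refine (h.dualFan hz).le_volume ?_ ⟨z, h.mem_convexHull hz, sub_self z⟩
    (fun i => ⟨p i, subset_convexHull ℝ _ ⟨i, rfl⟩, rfl⟩) (h.inner_dualVertex_le hz) ?_
  · simpa [sub_eq_add_neg, add_comm] using (convex_convexHull ℝ (Set.range p)).translate (-z)
  · intro i hi j hj hij
    -- An endpoint of edge j lies off edge i; the cases choose it, adding `n` to its index when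
    -- needed.
    by_cases c1 : i + 1 < j
    · exact Or.inl (h.inner_dualVertex_lt hz c1 (by omega))
    by_cases c2 : j = i + 1
    · exact Or.inr (h.inner_dualVertex_lt hz (by omega) (by omega))
    by_cases c3 : i + 1 < j + n
    · left
      rw [← h.periodic j]
      exact h.inner_dualVertex_lt hz c3 (by omega)
    · right
      rw [← h.periodic (j + 1)]
      exact h.inner_dualVertex_lt hz (by omega) (by omega)

lemma le_volume_polar (h : ConvexPolygon n p) (hz : ∀ i, 0 < edgeArea p z i) :
    ENNReal.ofReal (polarDoubleArea n p z / 2) ≤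
      volume (polarBody (convexHull ℝ (Set.range p)) z) := by
  rw [← volume_image_sub _ z, ← sum_cross_dualVertex]
  have h3 := h.three_le
  refine (h.dualFan hz).swap.le_volume ?_ ⟨z, ?_, sub_self z⟩
    (fun i => ⟨z + dualVertex p z i, ?_, add_sub_cancel_left _ _⟩) ?_ ?_
  · simpa [sub_eq_add_neg, add_comm] using
      (convex_polarBody (convexHull ℝ (Set.range p)) z).translate (-z)
  · intro x _; simp
  · rw [mem_polarBody_convexHull]
    rintro _ ⟨j, rfl⟩
    rw [add_sub_cancel_left]
    exact h.inner_dualVertex_le hz i j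
  · intro i j
    rw [real_inner_comm]
    exact h.inner_dualVertex_le hz j (i + 1)
  · intro i hi j hj hij
    rw [real_inner_comm, real_inner_comm (dualVertex p z (j + 1))]
    by_cases c1 : i + 1 < j
    · left
      rw [← h.periodic (i + 1)]
      exact h.inner_dualVertex_lt hz (by omega) (by omega)
    by_cases c2 : i + 1 = j
    · right
      rw [← h.periodic (i + 1)]
      exact h.inner_dualVertex_lt hz (by omega) (by omega)
    by_cases c3 : i + 1 < j + n
    · exact Or.inl (h.inner_dualVertex_lt hz (by omega) c3)
    · exact Or.inr (h.inner_dualVertex_lt hz (by omega) (by omega))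

end ConvexPolygon
end VolumeProduct

/-! ### Minkowski's inequality for the mixed area form. -/

namespace VolumeProduct

/-- A discrete Picone inequality: a second order difference form is nonpositive on functions
vanishing at both ends of an interval in which the Jacobi equation has a positive solution. -/
lemma sum_form_nonpos_of_positive_solution {a c h g : ℕ → ℝ} {m : ℕ} (g0 : g 0 = 0)
    (gm : g m = 0)
    (ha : ∀ i, 0 < a i) (h0 : 0 ≤ h 0) (hpos : ∀ i, 0 < i → i < m → 0 < h i) (hm : 0 ≤ h m)
    (hh : ∀ i, c i * h (i + 1) = h i / a i + h (i + 2) / a (i + 1)) :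
    ∑ i ∈ Finset.range m, (2 * g i * g (i + 1) / a i - c i * g (i + 1) ^ 2) ≤ 0 := by
  -- The right side is the boundary term left after eliminating `c` through `h` and completing
  -- squares.
  have key : ∀ k, k + 1 < m →
      ∑ i ∈ Finset.range (k + 1), (2 * g i * g (i + 1) / a i - c i * g (i + 1) ^ 2) ≤
        - (g (k + 1) ^ 2 * h (k + 2) / (a (k + 1) * h (k + 1))) := by
    intro k
    induction k with
    | zero =>
      intro hk
      have h1 := hpos 1 (by norm_num) hk
      have a0 := ha 0
      have a1 := ha 1
      have e := hh 0
      simp only [zero_add, Finset.sum_range_one, g0] at *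
      have hc : c 0 = (h 0 / a 0 + h 2 / a 1) / h 1 := by rw [← e]; field_simp
      have : g 1 ^ 2 * h 2 / (a 1 * h 1) = g 1 ^ 2 * (h 2 / a 1) / h 1 := by field_simp
      rw [this, hc]
      have : 0 ≤ g 1 ^ 2 * (h 0 / a 0) / h 1 := by positivity
      have e2 : (h 0 / a 0 + h 2 / a 1) / h 1 * g 1 ^ 2 =
        g 1 ^ 2 * (h 0 / a 0) / h 1 + g 1 ^ 2 * (h 2 / a 1) / h 1 := by field_simp
      rw [e2]
      simp only [mul_zero, zero_mul, zero_div]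
      linarith
    | succ k ih =>
      intro hk
      have ih := ih (by omega)
      rw [Finset.sum_range_succ]
      have h1 := hpos (k + 1) (by omega) (by omega)
      have h2 := hpos (k + 2) (by omega) (by omega)
      have a1 := ha (k + 1)
      have a2 := ha (k + 2)
      have e := hh (k + 1)
      simp only [show k + 1 + 1 = k + 2 by ring, show k + 1 + 2 = k + 3 by ring] at *
      have hc : c (k + 1) = (h (k + 1) / a (k + 1) + h (k + 3) / a (k + 2)) / h (k + 2) := by
        rw [← e]; field_simp
      have sq : 0 ≤ (g (k + 1) * h (k + 2) - g (k + 2) * h (k + 1)) ^ 2 /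
          (a (k + 1) * h (k + 1) * h (k + 2)) := by positivity
      have id : - (g (k + 1) ^ 2 * h (k + 2) / (a (k + 1) * h (k + 1))) +
          (2 * g (k + 1) * g (k + 2) / a (k + 1) - c (k + 1) * g (k + 2) ^ 2) =
          -(g (k + 2) ^ 2 * h (k + 3) / (a (k + 2) * h (k + 2))) -
          (g (k + 1) * h (k + 2) - g (k + 2) * h (k + 1)) ^ 2 /
          (a (k + 1) * h (k + 1) * h (k + 2)) := by
        rw [hc]; field_simp; ring
      linarith
  rcases m with _ | m
  · simp
  rw [Finset.sum_range_succ, gm]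
  rcases m with _ | m
  · simp
  have := key m (by omega)
  have h1 := hpos (m + 1) (by omega) (by omega)
  have a1 := ha (m + 1)
  -- After the two case splits `m + 2` is the right end of the interval, where `h` may vanish.
  have : 0 ≤ g (m + 1) ^ 2 * h (m + 2) / (a (m + 1) * h (m + 1)) := by positivity
  simp only [mul_zero, zero_div, ne_eq, OfNat.ofNat_ne_zero, not_false_eq_true, zero_pow,
    sub_zero, add_zero]
  linarith

/-- Twice the area of the triangle that the `i`-th edge of the polar polygon spans with `z`. -/
noncomputable def dualWeight (p : ℕ → Plane) (z : Plane) (i : ℕ) : ℝ :=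
  corner p i / (edgeArea p z i * edgeArea p z (i + 1))

/-- The potential of the discrete Jacobi equation satisfied by the vertices of a polygon. -/
noncomputable def potential (p : ℕ → Plane) (z : Plane) (i : ℕ) : ℝ :=
  1 / edgeArea p z i + 1 / edgeArea p z (i + 1) - dualWeight p z i

/-- The discrete Jacobi operator of a polygon; it gives (normalized) edge lengths of the polygon
with support numbers `f` and the normals of the polar polygon. -/
noncomputable def jacobi (p : ℕ → Plane) (z : Plane) (f : ℕ → ℝ) (i : ℕ) : ℝ :=
  f i / edgeArea p z i + f (i + 2) / edgeArea p z (i + 1) - potential p z i * f (i + 1)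

/-- Four times the mixed area of polygons with the normals of the polar polygon. -/
noncomputable def mixedArea (n : ℕ) (p : ℕ → Plane) (z : Plane) (f g : ℕ → ℝ) : ℝ :=
  ∑ i ∈ Finset.range n, g (i + 1) * jacobi p z f i

/-- The polar polygon has support numbers 1, so the form takes the value `polarDoubleArea n p z` on
the constant 1. -/
lemma jacobi_one (p : ℕ → Plane) (z : Plane) (i : ℕ) :
    jacobi p z (fun _ => 1) i = dualWeight p z i := by
  simp [jacobi, potential]

lemma jacobi_add_smul (p : ℕ → Plane) (z : Plane) (f g : ℕ → ℝ) (t : ℝ) (i : ℕ) :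
    jacobi p z (fun i => f i + t * g i) i = jacobi p z f i + t * jacobi p z g i := by
  unfold jacobi; ring

lemma mixedArea_add_smul_left (n : ℕ) (p : ℕ → Plane) (z : Plane) (f g k : ℕ → ℝ) (t : ℝ) :
    mixedArea n p z (fun i => f i + t * g i) k =
      mixedArea n p z f k + t * mixedArea n p z g k := by
  simp only [mixedArea, jacobi_add_smul, Finset.mul_sum, ← Finset.sum_add_distrib]
  exact Finset.sum_congr rfl fun i _ => by ring

lemma mixedArea_add_smul_right (n : ℕ) (p : ℕ → Plane) (z : Plane) (f g k : ℕ → ℝ) (t : ℝ) :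
    mixedArea n p z k (fun i => f i + t * g i) =
      mixedArea n p z k f + t * mixedArea n p z k g := by
  simp only [mixedArea, Finset.mul_sum, ← Finset.sum_add_distrib]
  exact Finset.sum_congr rfl fun i _ => by ring

lemma exists_inner_eq {a b : Plane} (h : cross a b ≠ 0) (s t : ℝ) :
    ∃ ξ : Plane, inner ℝ ξ a = s ∧ inner ℝ ξ b = t := by
  refine ⟨!₂[(s * b 1 - t * a 1) / cross a b, (t * a 0 - s * b 0) / cross a b], ?_, ?_⟩
  · rw [inner_eq]
    simp only [Matrix.cons_val_zero, Matrix.cons_val_one]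
    field_simp
    unfold cross; ring
  · rw [inner_eq]
    simp only [Matrix.cons_val_zero, Matrix.cons_val_one]
    field_simp
    unfold cross; ring

namespace ConvexPolygon

variable {n : ℕ} {p : ℕ → Plane} {z : Plane} {f g : ℕ → ℝ}

/-- These are the support numbers of the single point `ξ`, all of whose edges have length zero.
Hence linear functions lie in the kernel of the form. -/
lemma jacobi_inner (hz : ∀ i, 0 < edgeArea p z i) (ξ : Plane) (i : ℕ) :
    jacobi p z (fun i => inner ℝ ξ (p i - z)) i = 0 := by
  have h0 := (hz i).ne'
  have h1 := (hz (i + 1)).ne'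
  simp only [jacobi, potential, dualWeight]
  field_simp
  simp only [inner_eq, edgeArea, corner, cross, PiLp.sub_apply]
  ring

lemma periodic_potential (h : ConvexPolygon n p) : Function.Periodic (potential p z) n := by
  intro i
  simp only [potential, dualWeight, corner, show i + n + 1 = i + 1 + n by ring,
    show i + n + 2 = i + 2 + n by ring, h.periodic _, h.periodic_edgeArea z _]

lemma periodic_jacobi (h : ConvexPolygon n p) (hf : Function.Periodic f n) :
    Function.Periodic (jacobi p z f) n := by
  intro i
  simp only [jacobi, h.periodic_potential i, show i + n + 1 = i + 1 + n by ring,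
    show i + n + 2 = i + 2 + n by ring, hf _, h.periodic_edgeArea z _]

/-- Summation by parts over a period puts the form in a visibly symmetric shape. -/
lemma mixedArea_eq (h : ConvexPolygon n p) (hf : Function.Periodic f n)
    (hg : Function.Periodic g n) :
    mixedArea n p z f g = ∑ i ∈ Finset.range n,
      ((f i * g (i + 1) + f (i + 1) * g i) / edgeArea p z i -
        potential p z i * (f (i + 1) * g (i + 1))) := by
  have hs := sum_range_shift (f := fun i => f (i + 1) * g i / edgeArea p z i) (n := n)
    (fun i => by
      simp only [show i + n + 1 = i + 1 + n by ring, hf _, hg _, h.periodic_edgeArea z _])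
  have e1 : mixedArea n p z f g = ∑ i ∈ Finset.range n,
      (f i * g (i + 1) / edgeArea p z i - potential p z i * (f (i + 1) * g (i + 1))) +
      ∑ i ∈ Finset.range n, f (i + 1 + 1) * g (i + 1) / edgeArea p z (i + 1) := by
    rw [← Finset.sum_add_distrib]
    exact Finset.sum_congr rfl fun i _ => by unfold jacobi; ring
  rw [e1, hs, ← Finset.sum_add_distrib]
  exact Finset.sum_congr rfl fun i _ => by ring

lemma mixedArea_comm (h : ConvexPolygon n p) (hf : Function.Periodic f n)
    (hg : Function.Periodic g n) : mixedArea n p z f g = mixedArea n p z g f := by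
  rw [h.mixedArea_eq hf hg, h.mixedArea_eq hg hf]
  exact Finset.sum_congr rfl fun i _ => by ring

/-- Once the vertices have passed the ray opposite to the first one, they stay beyond it. -/
lemma cross_vertex_neg_of_nonpos (h : ConvexPolygon n p) (hz : ∀ i, 0 < edgeArea p z i) {i : ℕ}
    (h1 : 1 ≤ i) (h2 : i + 1 < n) (hi : cross (p 0 - z) (p i - z) ≤ 0) :
    cross (p 0 - z) (p (i + 1) - z) < 0 := by
  by_contra hc
  rw [not_lt] at hc
  have ha : 0 < cross (p i - z) (p (i + 1) - z) := hz i
  -- Otherwise `p 0 - z` lies in the cone of edge i with coordinates s, t. The functional of edge i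
  -- gives s + t < 1, that of edge 0 gives s + t ≥ 1.
  have e := eq_combo ha.ne' (p 0 - z)
  set s := cross (p 0 - z) (p (i + 1) - z) / cross (p i - z) (p (i + 1) - z)
  set t := cross (p i - z) (p 0 - z) / cross (p i - z) (p (i + 1) - z)
  have hs : 0 ≤ s := div_nonneg hc ha.le
  have ht : 0 ≤ t := by
    apply div_nonneg _ ha.le
    have : cross (p i - z) (p 0 - z) = - cross (p 0 - z) (p i - z) := by unfold cross; ring
    linarith
  have D := h.dualFan hz
  have w1 := h.inner_dualVertex_lt hz (i := i) (j := n) (by omega) (by omega)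
  have hn : p n = p 0 := by simpa using h.periodic 0
  have w2 := D.inner_combo i s t
  rw [hn] at w1
  rw [← e] at w2
  have w3 := D.inner_self 0
  rw [e, inner_add_right, inner_smul_right, inner_smul_right] at w3
  have w4 := mul_le_mul_of_nonneg_left (h.inner_dualVertex_le hz 0 i) hs
  have w5 := mul_le_mul_of_nonneg_left (h.inner_dualVertex_le hz 0 (i + 1)) ht
  linarith

/-- The ray from `z` opposite to `p 0` meets the edge from `p j` to `p (j + 1)`. Only a weak sign
holds at `j + 1`, since that vertex may lie on the ray. -/
lemma exists_opposite_edge (h : ConvexPolygon n p) (hz : ∀ i, 0 < edgeArea p z i) :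
    ∃ j, j + 1 < n ∧ (∀ i, 0 < i → i ≤ j → 0 < cross (p 0 - z) (p i - z)) ∧
      (∀ i, j < i → i < n → cross (p 0 - z) (p i - z) ≤ 0) ∧
      (∀ i, j + 1 < i → i < n → cross (p 0 - z) (p i - z) < 0) ∧ 0 < j := by
  classical
  have hn : p n = p 0 := by simpa using h.periodic 0
  have h3 := h.three_le
  have hlast : cross (p 0 - z) (p (n - 1) - z) < 0 := by
    have := hz (n - 1)
    rw [edgeArea, show n - 1 + 1 = n by omega, hn] at this
    have e : cross (p 0 - z) (p (n - 1) - z) = - cross (p (n - 1) - z) (p 0 - z) := by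
      unfold cross; ring
    linarith
  have hex : ∃ k, 0 < k ∧ cross (p 0 - z) (p k - z) ≤ 0 := ⟨n - 1, by omega, hlast.le⟩
  set k := Nat.find hex
  obtain ⟨k0, hk⟩ := Nat.find_spec hex
  have kn : k ≤ n - 1 := Nat.find_min' hex ⟨by omega, hlast.le⟩
  have hmin : ∀ i, 0 < i → i < k → 0 < cross (p 0 - z) (p i - z) := fun i i0 ik => by
    have := Nat.find_min hex ik
    by_contra hc
    exact this ⟨i0, not_lt.1 hc⟩
  have k1 : k ≠ 1 := fun e => by
    change cross (p 0 - z) (p k - z) ≤ 0 at hk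
    rw [e] at hk
    have := hz 0
    unfold edgeArea at this
    simp only [zero_add] at this
    linarith
  have hneg : ∀ d, k + (d + 1) < n → cross (p 0 - z) (p (k + (d + 1)) - z) < 0 := by
    intro d
    induction d with
    | zero => intro hd; exact h.cross_vertex_neg_of_nonpos hz (by omega) hd hk
    | succ d ih =>
      intro hd
      exact h.cross_vertex_neg_of_nonpos hz (i := k + (d + 1)) (by omega) (by omega)
        (ih (by omega)).le
  have hneg' : ∀ i, k < i → i < n → cross (p 0 - z) (p i - z) < 0 := by
    intro i i1 i2
    have := hneg (i - k - 1)
    rw [show k + (i - k - 1 + 1) = i by omega] at this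
    exact this i2
  refine ⟨k - 1, by omega, fun i i0 ik => hmin i i0 (by omega), fun i i1 i2 => ?_,
    fun i i1 i2 => hneg' i (by omega) i2, by omega⟩
  rcases eq_or_ne i k with rfl | hne
  · exact hk
  · exact (hneg' i (by omega) i2).le

lemma jacobi_cross (hz : ∀ i, 0 < edgeArea p z i) (e : Plane) (i : ℕ) :
    potential p z i * cross e (p (i + 1) - z) =
      cross e (p i - z) / edgeArea p z i + cross e (p (i + 2) - z) / edgeArea p z (i + 1) := by
  have := jacobi_inner hz !₂[-e 1, e 0] i
  have ec : ∀ x, inner ℝ !₂[-e 1, e 0] x = cross e x := fun x => by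
    rw [inner_eq]; simp [cross]; ring
  simp only [jacobi, ec] at this
  linarith

/-- The zeros at 0, j and j + 1 split the form into two Dirichlet problems. `cross (p 0 - z) (p i -
z)` solves the Jacobi equation, positively inside the first arc; its negative serves on the second.
-/
lemma mixedArea_self_nonpos_of_vanish (h : ConvexPolygon n p) (hz : ∀ i, 0 < edgeArea p z i)
    (hg : Function.Periodic g n) {j : ℕ} (jn : j + 1 < n)
    (hpos : ∀ i, 0 < i → i ≤ j → 0 < cross (p 0 - z) (p i - z))
    (hnonpos : ∀ i, j < i → i < n → cross (p 0 - z) (p i - z) ≤ 0)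
    (hneg : ∀ i, j + 1 < i → i < n → cross (p 0 - z) (p i - z) < 0)
    (g0 : g 0 = 0) (gj : g j = 0) (gj' : g (j + 1) = 0) :
    mixedArea n p z g g ≤ 0 := by
  have h00 : cross (p 0 - z) (p 0 - z) = 0 := by unfold cross; ring
  have hn : p n = p 0 := by simpa using h.periodic 0
  have gn : g n = 0 := by rw [← g0]; simpa using hg 0
  rw [h.mixedArea_eq hg hg]
  have e : ∀ i, (g i * g (i + 1) + g (i + 1) * g i) / edgeArea p z i -
        potential p z i * (g (i + 1) * g (i + 1)) =
        2 * g i * g (i + 1) / edgeArea p z i - potential p z i * g (i + 1) ^ 2 := by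
    intro i; ring
  simp only [e]
  have s1 := sum_form_nonpos_of_positive_solution (a := edgeArea p z) (c := potential p z)
    (h := fun i => cross (p 0 - z) (p i - z)) (g := g) (m := j) g0 gj hz h00.ge
    (fun i i0 ij => hpos i i0 ij.le)
    (by
      rcases Nat.eq_zero_or_pos j with rfl | hj
      · exact h00.ge
      · exact (hpos j hj le_rfl).le)
    (jacobi_cross hz _)
  have s2 := sum_form_nonpos_of_positive_solution
    (a := fun i => edgeArea p z (j + 1 + i)) (c := fun i => potential p z (j + 1 + i))
    (h := fun i => - cross (p 0 - z) (p (j + 1 + i) - z)) (g := fun i => g (j + 1 + i))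
    (m := n - (j + 1)) gj' (by rw [show j + 1 + (n - (j + 1)) = n by omega, gn])
    (fun i => hz _) (by simpa using hnonpos (j + 1) (by omega) jn)
    (fun i i0 ij => by simpa using hneg (j + 1 + i) (by omega) (by omega))
    (by rw [show j + 1 + (n - (j + 1)) = n by omega, hn, h00]; simp)
    (fun i => by
      have := jacobi_cross hz (p 0 - z) (j + 1 + i)
      simp only [← add_assoc] at this ⊢
      linear_combination -this)
  obtain ⟨d, rfl⟩ : ∃ d, n = j + 1 + d := ⟨n - (j + 1), by omega⟩
  rw [Finset.sum_range_add, Finset.sum_range_succ]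
  simp only [add_tsub_cancel_left] at s2
  simp only [gj, gj', ← add_assoc] at s2 ⊢
  simp only [mul_zero, zero_div, ne_eq, OfNat.ofNat_ne_zero, not_false_eq_true, zero_pow,
    sub_zero, add_zero]
  linarith

/-- Minkowski's inequality: the mixed area form is nonpositive on the orthogonal complement of the
polar polygon. -/
theorem mixedArea_self_nonpos (h : ConvexPolygon n p) (hz : ∀ i, 0 < edgeArea p z i)
    (hf : Function.Periodic f n) (h1 : mixedArea n p z (fun _ => 1) f = 0) :
    mixedArea n p z f f ≤ 0 := by
  obtain ⟨j, jn, hpos, hnonpos, hneg, j0⟩ := h.exists_opposite_edge hz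
  have hΔ : cross (p j - p 0) (p (j + 1) - p 0) ≠ 0 := by
    have a1 := hz j
    have a2 := hpos j j0 le_rfl
    have a3 := hnonpos (j + 1) (by omega) jn
    have : cross (p j - p 0) (p (j + 1) - p 0) = edgeArea p z j +
        cross (p 0 - z) (p j - z) - cross (p 0 - z) (p (j + 1) - z) := by
      simp [cross, edgeArea]; ring
    rw [this]
    linarith
  -- Subtract from `f` the affine function interpolating it at the non-collinear vertices 0, j, j +
  -- 1. The linear part is in the kernel, so the form of the difference `g` is that of `f` plus r²
  -- times that of 1.
  obtain ⟨ξ, x1, x2⟩ := exists_inner_eq hΔ (f j - f 0) (f (j + 1) - f 0)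
  set r := f 0 - inner ℝ ξ (p 0 - z) with hr
  set l : ℕ → ℝ := fun i => inner ℝ ξ (p i - z)
  have hl : Function.Periodic l n := fun i => by simp only [l, h.periodic i]
  have hone : Function.Periodic (fun _ : ℕ => (1 : ℝ)) n := fun i => rfl
  have hshift : ∀ i, l i = inner ℝ ξ (p i - p 0) + l 0 := fun i => by
    simp only [l]; rw [← inner_add_right]; congr 1; abel
  have hl0 : ∀ k : ℕ → ℝ, mixedArea n p z l k = 0 := fun k => by
    simp only [mixedArea, l, jacobi_inner hz, mul_zero, Finset.sum_const_zero]
  set e : ℕ → ℝ := fun i => f i + (-r) * (fun _ => (1 : ℝ)) i with he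
  have hep : Function.Periodic e n := fun i => by simp only [e, hf i]
  set g : ℕ → ℝ := fun i => e i + (-1) * l i with hg
  have hgp : Function.Periodic g n := fun i => by simp only [g, hep i, hl i]
  have hB := h.mixedArea_self_nonpos_of_vanish hz hgp jn hpos hnonpos hneg
    (by simp only [g, e, hr, l]; ring)
    (by simp only [g, e, hshift j, x1, hr]; simp only [l]; ring)
    (by simp only [g, e, hshift (j + 1), x2, hr]; simp only [l]; ring)
  have hT : 0 ≤ mixedArea n p z (fun _ => 1) (fun _ => 1) := by
    apply Finset.sum_nonneg
    intro i _
    rw [jacobi_one, one_mul]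
    exact div_nonneg (h.corner_pos i).le (mul_pos (hz i) (hz _)).le
  rw [hg, mixedArea_add_smul_left, mixedArea_add_smul_right, hl0, h.mixedArea_comm hep hl, hl0,
    he, mixedArea_add_smul_left, mixedArea_add_smul_right, mixedArea_add_smul_right, h1,
    h.mixedArea_comm hf hone, h1] at hB
  have := mul_nonneg (mul_self_nonneg r) hT
  linarith

/-- The equality case of Minkowski's inequality. -/
theorem exists_eq_inner_of_mixedArea_eq_zero (h : ConvexPolygon n p)
    (hz : ∀ i, 0 < edgeArea p z i)
    (hf : Function.Periodic f n) (h1 : mixedArea n p z (fun _ => 1) f = 0)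
    (h0 : mixedArea n p z f f = 0) : ∃ ξ : Plane, ∀ i, f i = inner ℝ ξ (p i - z) := by
  have hone : Function.Periodic (fun _ : ℕ => (1 : ℝ)) n := fun i => rfl
  have hT : 0 < mixedArea n p z (fun _ => 1) (fun _ => 1) := by
    apply Finset.sum_pos
    · intro i _
      rw [jacobi_one, one_mul]
      exact div_pos (h.corner_pos i) (mul_pos (hz i) (hz _))
    · exact ⟨0, by simpa using h.pos⟩
  -- a null vector of a semidefinite form lies in its kernel
  have hker : ∀ k : ℕ → ℝ, Function.Periodic k n → mixedArea n p z f k = 0 := by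
    intro k hk
    set s := mixedArea n p z (fun _ => 1) k / mixedArea n p z (fun _ => 1) (fun _ => 1) with hs
    set e : ℕ → ℝ := fun i => k i + (-s) * (fun _ => (1 : ℝ)) i with he
    have hep : Function.Periodic e n := fun i => by simp only [e, hk i]
    have he1 : mixedArea n p z (fun _ => 1) e = 0 := by
      rw [he, mixedArea_add_smul_right, hs]; field_simp; ring
    have hfe : mixedArea n p z f e = mixedArea n p z f k := by
      rw [he, mixedArea_add_smul_right, h.mixedArea_comm hf hone, h1]; ring
    rw [← hfe]
    clear_value e
    -- All `f + t e` stay orthogonal to 1, so the coefficient linear in t must vanish.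
    have hq : ∀ t : ℝ, 2 * t * mixedArea n p z f e + t * t * mixedArea n p z e e ≤ 0 := by
      intro t
      have hp : Function.Periodic (fun i => f i + t * e i) n := fun i => by
        simp only [hf i, hep i]
      have := h.mixedArea_self_nonpos hz hp (by rw [mixedArea_add_smul_right, h1, he1]; ring)
      rw [mixedArea_add_smul_left n p z f e, mixedArea_add_smul_right n p z f e f,
        mixedArea_add_smul_right n p z f e e, h0, h.mixedArea_comm hep hf] at this
      linarith
    set x := mixedArea n p z f e
    set y := mixedArea n p z e e
    by_contra hx
    have hy : 0 < 1 + |y| := by positivity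
    have := hq (x / (1 + |y|))
    have e1 : 2 * (x / (1 + |y|)) * x + x / (1 + |y|) * (x / (1 + |y|)) * y =
        x ^ 2 / (1 + |y|) ^ 2 * (2 * (1 + |y|) + y) := by field_simp
    rw [e1] at this
    have h2 : 0 < 2 * (1 + |y|) + y := by have := neg_abs_le y; have := abs_nonneg y; linarith
    have : 0 < x ^ 2 / (1 + |y|) ^ 2 * (2 * (1 + |y|) + y) := by positivity
    linarith
  have hjac : ∀ i, jacobi p z f i = 0 := by
    have hJ := h.periodic_jacobi (z := z) hf
    obtain ⟨N, hN⟩ : ∃ N, N + 1 = n := ⟨n - 1, by have := h.pos; omega⟩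
    -- The form pairs `g (i + 1)` with `jacobi i`; the shift by n - 1 realigns the indices and
    -- yields a sum of squares.
    have := hker (fun i => jacobi p z f (i + N)) (fun i => by
      simp only []; rw [show i + n + N = i + N + n by ring, hJ])
    simp only [mixedArea] at this
    have e : ∀ i, jacobi p z f (i + 1 + N) = jacobi p z f i := fun i => by
      rw [show i + 1 + N = i + n by omega, hJ]
    simp only [e] at this
    rw [Finset.sum_eq_zero_iff_of_nonneg (fun i _ => mul_self_nonneg _)] at this
    intro i
    rw [← hJ.map_mod_nat i]
    exact mul_self_eq_zero.1 (this _ (Finset.mem_range.2 (Nat.mod_lt _ h.pos)))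
  -- The Jacobi equation is a second-order recurrence, so matching a linear function at 0 and 1 is
  -- enough.
  obtain ⟨ξ, x0, x1⟩ := exists_inner_eq (hz 0).ne' (f 0) (f 1)
  refine ⟨ξ, ?_⟩
  have hrec : ∀ i, f i = inner ℝ ξ (p i - z) ∧ f (i + 1) = inner ℝ ξ (p (i + 1) - z) := by
    intro i
    induction i with
    | zero => exact ⟨x0.symm, x1.symm⟩
    | succ i ih =>
      refine ⟨ih.2, ?_⟩
      have e1 := hjac i
      have e2 := jacobi_inner hz ξ i
      unfold jacobi at e1 e2
      rw [ih.1, ih.2] at e1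
      have := (hz (i + 1)).ne'
      have e3 : f (i + 2) / edgeArea p z (i + 1) =
          inner ℝ ξ (p (i + 2) - z) / edgeArea p z (i + 1) := by linarith
      field_simp at e3
      exact e3
  exact fun i => (hrec i).1

end ConvexPolygon
end VolumeProduct

/-! ### Existence of a balanced center. -/

namespace VolumeProduct

/-- A convex set is contractible, so `g` lifts through the covering map `Complex.exp`. -/
lemma exists_continuousOn_log {K : Set Plane} (hK : Convex ℝ K) (hne : K.Nonempty)
    {g : Plane → ℂ} (hg : ContinuousOn g K) (h0 : ∀ z ∈ K, g z ≠ 0) :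
    ∃ f : Plane → ℂ, ContinuousOn f K ∧ ∀ z ∈ K, Complex.exp (f z) = g z := by
  classical
  have := hK.contractibleSpace hne
  have := hK.locallyPathConnectedSpace
  obtain ⟨x₀, hx₀⟩ := hne
  obtain ⟨F, ⟨-, hF⟩, -⟩ := Complex.isCoveringMapOn_exp.existsUnique_continuousMap_lifts
    (⟨fun x : K => g x, continuousOn_iff_continuous_domRestrict.mp hg⟩ : C(K, ℂ))
    (a₀ := ⟨x₀, hx₀⟩) (Complex.exp_log (h0 x₀ hx₀)) (fun x => h0 x x.2)
  refine ⟨fun z => if hz : z ∈ K then F ⟨z, hz⟩ else 0, ?_, fun z hz => ?_⟩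
  · rw [continuousOn_iff_continuous_domRestrict]
    convert! map_continuous F
    ext z
    simp
  · simp only [dif_pos hz]
    exact congr_fun hF ⟨z, hz⟩

lemma eq_of_continuousOn_of_int {s : Set Plane} (hs : IsPreconnected s) {f : Plane → ℝ}
    (hf : ContinuousOn f s) (hint : ∀ x ∈ s, ∃ N : ℤ, f x = N) {x y : Plane} (hx : x ∈ s)
    (hy : y ∈ s) : f x = f y := by
  have hd : IsDiscrete (Set.range (fun N : ℤ => (N : ℝ))) :=
    Int.isClosedEmbedding_coe_real.isEmbedding.isDiscrete_range
  exact hs.constant_of_mapsTo (T := Set.range (fun N : ℤ => (N : ℝ))) hd hf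
    (fun x hx => by obtain ⟨N, hN⟩ := hint x hx; exact ⟨N, hN.symm⟩) hx hy

lemma prod_range_shift {n : ℕ} {f : ℕ → ℝ} (hf : Function.Periodic f n) (h0 : ∀ i, f i ≠ 0)
    (m : ℕ) : ∏ i ∈ Finset.range n, f (m + i) = ∏ i ∈ Finset.range n, f i := by
  induction m with
  | zero => simp
  | succ m ih =>
    rw [← ih]
    have h := Finset.prod_range_succ' (fun i => f (m + i)) n
    rw [Finset.prod_range_succ] at h
    simp only [hf m, add_zero] at h
    rw [← mul_right_cancel₀ (h0 m) h.symm]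
    exact Finset.prod_congr rfl fun i _ => by congr 1; ring

/-- The fraction of the area of the polygon swept from `p 0` to `p k`, as seen from `z`. -/
noncomputable def phase (n : ℕ) (p : ℕ → Plane) (z : Plane) (k : ℕ) : ℝ :=
  (∑ j ∈ Finset.range k, edgeArea p z j) / doubleArea n p

/-- The point of the unit circle corresponding to the vertex `p k` under the parametrization of the
circle by the area that the polygon sweeps as seen from `z`. -/
noncomputable def circlePoint (n : ℕ) (p : ℕ → Plane) (z : Plane) (k : ℕ) : ℂ :=
  Complex.exp ((2 * Real.pi * phase n p z k : ℝ) * Complex.I)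

/-- A positive multiple of `∑ dualWeight • circlePoint`, extended continuously to the boundary. -/
noncomputable def balance (n : ℕ) (p : ℕ → Plane) (z : Plane) : ℂ :=
  ∑ i ∈ Finset.range n,
    ((corner p i * ∏ t ∈ Finset.range (n - 2), edgeArea p z (i + 2 + t) : ℝ) : ℂ) *
      circlePoint n p z (i + 1)

lemma phase_succ (n : ℕ) (p : ℕ → Plane) (z : Plane) (k : ℕ) :
    phase n p z (k + 1) = phase n p z k + edgeArea p z k / doubleArea n p := by
  rw [phase, Finset.sum_range_succ, add_div]; rfl

lemma continuous_phase (n : ℕ) (p : ℕ → Plane) (k : ℕ) : Continuous fun z => phase n p z k := by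
  unfold phase
  exact (continuous_finsetSum _ fun j _ => continuous_edgeArea p j).div_const _

lemma continuous_circlePoint (n : ℕ) (p : ℕ → Plane) (k : ℕ) :
    Continuous fun z => circlePoint n p z k := by
  unfold circlePoint
  have := continuous_phase n p k
  fun_prop

lemma continuous_balance (n : ℕ) (p : ℕ → Plane) : Continuous (balance n p) := by
  unfold balance
  refine continuous_finsetSum _ fun i _ => ?_
  refine Continuous.mul ?_ (continuous_circlePoint n p _)
  exact Complex.continuous_ofReal.comp
    (continuous_const.mul (continuous_finsetProd _ fun j _ => continuous_edgeArea p _))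

namespace ConvexPolygon

variable {n : ℕ} {p : ℕ → Plane} {z : Plane}

lemma doubleArea_pos (h : ConvexPolygon n p) : 0 < doubleArea n p := by
  rw [← h.sum_edgeArea (p 0)]
  have h3 := h.three_le
  refine Finset.sum_pos' (fun i _ => h.edgeArea_vertex_nonneg i 0)
    ⟨1, Finset.mem_range.2 (by omega), ?_⟩
  have := h.edgeArea_vertex_pos (i := 1) (j := n) (by omega) (by omega)
  rwa [show p n = p 0 by simpa using h.periodic 0] at this

lemma phase_add_period (h : ConvexPolygon n p) (z : Plane) (k : ℕ) :
    phase n p z (k + n) = phase n p z k + 1 := by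
  unfold phase
  rw [add_comm k n, Finset.sum_range_add, h.sum_edgeArea]
  have e : ∀ i, edgeArea p z (n + i) = edgeArea p z i := fun i => by
    rw [add_comm, h.periodic_edgeArea]
  simp only [e]
  rw [add_div, div_self h.doubleArea_pos.ne', add_comm]

lemma periodic_circlePoint (h : ConvexPolygon n p) (z : Plane) :
    Function.Periodic (circlePoint n p z) n := by
  intro k
  unfold circlePoint
  rw [h.phase_add_period]
  have := Complex.exp_periodic ((2 * Real.pi * phase n p z k : ℝ) * Complex.I)
  rw [← this]
  congr 1
  push_cast; ring

lemma balance_eq (h : ConvexPolygon n p) (hz : ∀ i, 0 < edgeArea p z i) :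
    balance n p z = (∏ i ∈ Finset.range n, edgeArea p z i : ℝ) *
      ∑ i ∈ Finset.range n, (dualWeight p z i : ℂ) * circlePoint n p z (i + 1) := by
  unfold balance
  rw [Finset.mul_sum]
  refine Finset.sum_congr rfl fun i _ => ?_
  rw [← mul_assoc, ← Complex.ofReal_mul]
  congr 2
  rw [← prod_range_shift (h.periodic_edgeArea z) (fun j => (hz j).ne') i, dualWeight]
  obtain ⟨m, rfl⟩ : ∃ m, n = m + 2 := ⟨n - 2, by have := h.three_le; omega⟩
  rw [Finset.prod_range_succ', Finset.prod_range_succ', add_tsub_cancel_right]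
  have h0 := (hz i).ne'
  have h1 := (hz (i + 1)).ne'
  have e : ∀ t, edgeArea p z (i + (t + 1 + 1)) = edgeArea p z (i + 2 + t) := fun t => by
    congr 1; ring
  simp only [e, zero_add, add_zero]
  field_simp

/-- The i-th product omits only the factors i and i + 1, so on edge k just the terms i = k and i + 1
= k (cyclically) can survive. Both carry the same circle point, since `edgeArea p z k = 0` makes the
points k and k + 1 coincide. -/
lemma balance_of_edge (h : ConvexPolygon n p) (hz : z ∈ convexHull ℝ (Set.range p)) {k : ℕ}
    (hk : k < n) (hzk : edgeArea p z k = 0) :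
    ∃ c : ℝ, 0 < c ∧ balance n p z = c * circlePoint n p z k := by
  have h3 := h.three_le
  have hnn : ∀ i, 0 ≤ ∏ t ∈ Finset.range (n - 2), edgeArea p z (i + 2 + t) := fun i =>
    Finset.prod_nonneg fun t _ => h.edgeArea_nonneg hz _
  refine ⟨∑ i ∈ Finset.range n, corner p i * ∏ t ∈ Finset.range (n - 2), edgeArea p z (i + 2 + t),
    ?_, ?_⟩
  -- If `z = p (k + 1)`, take i = k; otherwise the cyclic predecessor of k works.
  · have hex : ∃ i < n, 0 < ∏ t ∈ Finset.range (n - 2), edgeArea p z (i + 2 + t) := by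
      obtain ⟨s, t, hs, ht, hst, e⟩ := h.mem_segment hz hzk
      rcases hs.eq_or_lt with rfl | hs
      · refine ⟨k, hk, Finset.prod_pos fun r hr => ?_⟩
        rw [Finset.mem_range] at hr
        rw [← e, edgeArea_combo p _ _ hst, zero_mul, zero_add]
        have t1 : t = 1 := by linarith
        rw [t1, one_mul, ← h.periodic (k + 1)]
        exact h.edgeArea_vertex_pos (by omega) (by omega)
      · have hpos : ∀ j, 0 < edgeArea p (p k) j → 0 < edgeArea p z j := fun j hj => by
          rw [← e, edgeArea_combo p _ _ hst]
          have := mul_pos hs hj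
          have := mul_nonneg ht (h.edgeArea_vertex_nonneg j (k + 1))
          linarith
        rcases Nat.eq_zero_or_pos k with rfl | hk0
        · refine ⟨n - 1, by omega, Finset.prod_pos fun r hr => hpos _ ?_⟩
          rw [Finset.mem_range] at hr
          rw [← h.periodic, ← h.periodic]
          exact h.edgeArea_vertex_pos (by omega) (by omega)
        · refine ⟨k - 1, by omega, Finset.prod_pos fun r hr => hpos _ ?_⟩
          rw [Finset.mem_range] at hr
          rw [← h.periodic]
          exact h.edgeArea_vertex_pos (by omega) (by omega)
    obtain ⟨i, hi, hpos⟩ := hex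
    exact Finset.sum_pos' (fun j _ => mul_nonneg (h.corner_pos j).le (hnn j))
      ⟨i, Finset.mem_range.2 hi, mul_pos (h.corner_pos i) hpos⟩
  · unfold balance
    rw [Complex.ofReal_sum, Finset.sum_mul]
    refine Finset.sum_congr rfl fun i hi => ?_
    rw [Finset.mem_range] at hi
    by_cases c1 : i = k
    · subst c1
      congr 1
      unfold circlePoint
      rw [phase_succ, hzk, zero_div, add_zero]
    by_cases c2 : i + 1 = k
    · rw [c2]
    by_cases c3 : i + 1 = k + n
    · rw [c3, h.periodic_circlePoint]
    have : ∏ t ∈ Finset.range (n - 2), edgeArea p z (i + 2 + t) = 0 := by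
      rcases lt_or_gt_of_ne c1 with hlt | hlt
      · refine Finset.prod_eq_zero (i := k - i - 2) (Finset.mem_range.2 (by omega)) ?_
        rw [show i + 2 + (k - i - 2) = k by omega, hzk]
      · refine Finset.prod_eq_zero (i := k + n - i - 2) (Finset.mem_range.2 (by omega)) ?_
        rw [show i + 2 + (k + n - i - 2) = k + n by omega, h.periodic_edgeArea, hzk]
    rw [this]; simp

/-- Hersch's trick: for a suitable center, the circle points weighted with the areas of the
triangles of the polar polygon are balanced. -/
theorem exists_balanced (h : ConvexPolygon n p) :
    ∃ z, (∀ i, 0 < edgeArea p z i) ∧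
      ∑ i ∈ Finset.range n, (dualWeight p z i : ℂ) * circlePoint n p z (i + 1) = 0 := by
  by_contra hcon
  push Not at hcon
  set K := convexHull ℝ (Set.range p) with hKdef
  have hpK : ∀ i, p i ∈ K := fun i => subset_convexHull ℝ _ ⟨i, rfl⟩
  have hne : ∀ z ∈ K, balance n p z ≠ 0 := by
    intro z hz
    by_cases hpos : ∀ i, 0 < edgeArea p z i
    · rw [h.balance_eq hpos]
      refine mul_ne_zero ?_ (hcon z hpos)
      exact_mod_cast (Finset.prod_pos fun i _ => hpos i).ne'
    · rw [h.edgeArea_pos_iff] at hpos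
      push Not at hpos
      obtain ⟨k, hk, hle⟩ := hpos
      obtain ⟨c, hc, e⟩ := h.balance_of_edge hz (Finset.mem_range.1 hk)
        (le_antisymm hle (h.edgeArea_nonneg hz k))
      rw [e]
      exact mul_ne_zero (by exact_mod_cast hc.ne') (Complex.exp_ne_zero _)
  obtain ⟨f, hf, hexp⟩ := exists_continuousOn_log (convex_convexHull ℝ (Set.range p))
    ⟨p 0, hpK 0⟩ (continuous_balance n p).continuousOn hne
  -- If `balance` had no zero on `K`, it would have a continuous argument `ψ` in units of full
  -- turns. Along edge k it differs from `phase k` by a constant integer.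
  set ψ : Plane → ℝ := fun z => (f z).im / (2 * Real.pi) with hψ
  have hψc : ContinuousOn ψ K := (Complex.continuous_im.comp_continuousOn hf).div_const _
  have hint : ∀ k < n, ∀ z ∈ K, edgeArea p z k = 0 → ∃ N : ℤ, ψ z - phase n p z k = N := by
    intro k hk z hz hzk
    obtain ⟨c, hc, e⟩ := h.balance_of_edge hz hk hzk
    have hlog : Complex.exp (f z) =
        Complex.exp ((Real.log c : ℂ) + (2 * Real.pi * phase n p z k : ℝ) * Complex.I) := by
      rw [hexp z hz, e, Complex.exp_add, ← Complex.ofReal_exp, Real.exp_log hc]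
      rfl
    obtain ⟨N, hN⟩ := Complex.exp_eq_exp_iff_exists_int.1 hlog
    refine ⟨N, ?_⟩
    have him := congrArg Complex.im hN
    simp at him
    have := Real.pi_pos
    simp only [ψ]
    rw [him]
    field_simp
    ring
  have hstep : ∀ k < n, ψ (p (k + 1)) - phase n p (p (k + 1)) (k + 1) =
      ψ (p k) - phase n p (p k) k := by
    intro k hk
    have hseg : segment ℝ (p k) (p (k + 1)) ⊆ K :=
      (convex_convexHull ℝ _).segment_subset (hpK k) (hpK (k + 1))
    have := eq_of_continuousOn_of_int (convex_segment (𝕜 := ℝ) (p k) (p (k + 1))).isPreconnected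
      (f := fun z => ψ z - phase n p z k)
      ((hψc.mono hseg).sub (continuous_phase n p k).continuousOn)
      (fun z hz => hint k hk z (hseg hz) (by
        obtain ⟨s, t, -, -, hst, rfl⟩ := hz
        rw [edgeArea_combo p _ _ hst, edgeArea_self, edgeArea_succ]; ring))
      (left_mem_segment ℝ _ _) (right_mem_segment ℝ _ _)
    rw [phase_succ, edgeArea_succ, zero_div, add_zero]
    exact this.symm
  have hall : ∀ k ≤ n, ψ (p k) - phase n p (p k) k = ψ (p 0) - phase n p (p 0) 0 := by
    intro k
    induction k with
    | zero => simp
    | succ k ih => intro hk; rw [hstep k (by omega), ih (by omega)]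
  -- After one circuit `ψ` returns to its value at `p 0`, but the phase has grown by 1.
  have hfin := hall n le_rfl
  have hpn : p n = p 0 := by simpa using h.periodic 0
  have hph := h.phase_add_period (p 0) 0
  rw [zero_add] at hph
  rw [hpn, hph] at hfin
  linarith

end ConvexPolygon
end VolumeProduct

/-! ### A tangent line inequality for sin²x / x. -/

section TangentLine

open Real

namespace VolumeProduct

lemma hasDerivAt_sin_sq_div {x : ℝ} (hx : x ≠ 0) :
    HasDerivAt (fun x : ℝ => sin x ^ 2 / x) (2 * sin x * cos x / x - sin x ^ 2 / x ^ 2) x := by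
  have := ((hasDerivAt_sin x).pow 2).div (hasDerivAt_id x) hx
  refine this.congr_deriv ?_
  simp
  field_simp

/-- Up to the factor 2 / x³ this is the second derivative of sin²x / x. It vanishes at 0 and has
derivative -2x² sin 2x. -/
lemma sq_mul_cos_sub_lt_zero {x : ℝ} (hx : 0 < x) (hx' : x ≤ π / 2) :
    x ^ 2 * cos (2 * x) - x * sin (2 * x) + sin x ^ 2 < 0 := by
  have hd : ∀ x : ℝ, HasDerivAt (fun x : ℝ => x ^ 2 * cos (2 * x) - x * sin (2 * x) + sin x ^ 2)
      (-2 * x ^ 2 * sin (2 * x)) x := by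
    intro x
    have h2 : HasDerivAt (fun x : ℝ => 2 * x) 2 x := by simpa using (hasDerivAt_id x).const_mul 2
    have := (((hasDerivAt_pow 2 x).mul h2.cos).sub ((hasDerivAt_id x).mul h2.sin)).add
      ((hasDerivAt_sin x).pow 2)
    refine this.congr_deriv ?_
    simp [sin_two_mul]
    ring
  have hanti : StrictAntiOn (fun x : ℝ => x ^ 2 * cos (2 * x) - x * sin (2 * x) + sin x ^ 2)
      (Set.Icc 0 (π / 2)) := by
    apply strictAntiOn_of_deriv_neg (convex_Icc _ _)
    · exact fun x _ => (hd x).continuousAt.continuousWithinAt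
    · intro x hx
      rw [interior_Icc, Set.mem_Ioo] at hx
      rw [(hd x).deriv]
      have := sin_pos_of_pos_of_lt_pi (x := 2 * x) (by linarith) (by linarith)
      have := pow_pos hx.1 2
      nlinarith [mul_pos this ‹0 < sin (2 * x)›]
  have := hanti (a := 0) (b := x) ⟨le_rfl, by positivity⟩ ⟨hx.le, hx'⟩ hx
  simpa using this

lemma strictAntiOn_deriv_sin_sq_div :
    StrictAntiOn (fun x : ℝ => 2 * sin x * cos x / x - sin x ^ 2 / x ^ 2)
      (Set.Ioc 0 (π / 2)) := by
  have hd : ∀ x : ℝ, 0 < x → HasDerivAt (fun x : ℝ => 2 * sin x * cos x / x - sin x ^ 2 / x ^ 2)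
      (2 / x ^ 3 * (x ^ 2 * cos (2 * x) - x * sin (2 * x) + sin x ^ 2)) x := by
    intro x hx
    have := ((((hasDerivAt_sin x).const_mul 2).mul (hasDerivAt_cos x)).div
      (hasDerivAt_id x) hx.ne').sub
      (((hasDerivAt_sin x).pow 2).div (hasDerivAt_pow 2 x) (by positivity))
    refine this.congr_deriv ?_
    simp [sin_two_mul, cos_two_mul']
    field_simp
    ring
  apply strictAntiOn_of_deriv_neg (convex_Ioc _ _)
  · exact fun x hx => (hd x hx.1).continuousAt.continuousWithinAt
  · intro x hx
    rw [interior_Ioc, Set.mem_Ioo] at hx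
    rw [(hd x hx.1).deriv]
    exact mul_neg_of_pos_of_neg (by have := hx.1; positivity) (sq_mul_cos_sub_lt_zero hx.1 hx.2.le)

lemma sin_sq_div_lt_tangent_of_le {x y : ℝ} (hx : 0 < x) (hx' : x ≤ π / 2) (hy : 0 < y)
    (hy' : y ≤ π / 2) (hxy : x ≠ y) :
    sin x ^ 2 / x < sin y ^ 2 / y +
      (2 * sin y * cos y / y - sin y ^ 2 / y ^ 2) * (x - y) := by
  have hc : ∀ {a b : ℝ}, 0 < a → ContinuousOn (fun x : ℝ => sin x ^ 2 / x) (Set.Icc a b) :=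
    fun ha t ht => (hasDerivAt_sin_sq_div (ha.trans_le ht.1).ne').continuousAt.continuousWithinAt
  rcases lt_or_gt_of_ne hxy with h | h
  · obtain ⟨c, ⟨c1, c2⟩, e⟩ := exists_hasDerivAt_eq_slope _ _ h (hc hx)
      (fun t ht => hasDerivAt_sin_sq_div (hx.trans ht.1).ne')
    have := strictAntiOn_deriv_sin_sq_div ⟨hx.trans c1, by linarith⟩ ⟨hy, hy'⟩ c2
    simp only at this e
    rw [e, lt_div_iff₀ (by linarith)] at this
    linarith
  · obtain ⟨c, ⟨c1, c2⟩, e⟩ := exists_hasDerivAt_eq_slope _ _ h (hc hy)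
      (fun t ht => hasDerivAt_sin_sq_div (hy.trans ht.1).ne')
    have := strictAntiOn_deriv_sin_sq_div ⟨hy, hy'⟩ ⟨hy.trans c1, by linarith⟩ c1
    simp only at this e
    rw [e, div_lt_iff₀ (by linarith)] at this
    linarith

/-- Concavity covers x ≤ π/2. Beyond that the function stays below its value at π/2, while the
tangent does not decrease because y ≤ π/3. -/
lemma sin_sq_div_lt_tangent {x y : ℝ} (hx : 0 < x) (hy : 0 < y)
    (hy' : y ≤ π / 3) (hxy : x ≠ y) :
    sin x ^ 2 / x < sin y ^ 2 / y +
      (2 * sin y * cos y / y - sin y ^ 2 / y ^ 2) * (x - y) := by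
  have hpi := pi_pos
  rcases le_or_gt x (π / 2) with h | h
  · exact sin_sq_div_lt_tangent_of_le hx h hy (by linarith) hxy
  have h1 := sin_sq_div_lt_tangent_of_le (x := π / 2) (by positivity) le_rfl hy (by linarith)
    (by linarith)
  have h2 : sin x ^ 2 / x ≤ sin (π / 2) ^ 2 / (π / 2) := by
    rw [sin_pi_div_two]
    apply div_le_div₀ (by norm_num) _ (by positivity) h.le
    rw [one_pow]
    nlinarith [neg_one_le_sin x, sin_le_one x]
  have hslope : 0 ≤ 2 * sin y * cos y / y - sin y ^ 2 / y ^ 2 := by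
    have hs := sin_pos_of_pos_of_lt_pi hy (by linarith)
    have hs' := sin_lt hy
    have hcos : 1 / 2 ≤ cos y := by
      rw [← cos_pi_div_three]
      exact cos_le_cos_of_nonneg_of_le_pi hy.le (by linarith) hy'
    have : 2 * sin y * cos y / y - sin y ^ 2 / y ^ 2 =
        sin y * (2 * y * cos y - sin y) / y ^ 2 := by field_simp
    rw [this]
    apply div_nonneg _ (by positivity)
    apply mul_nonneg hs.le
    nlinarith
  have h3 := mul_le_mul_of_nonneg_left (show π / 2 - y ≤ x - y by linarith) hslope
  linarith

/-- This is the intercept of the tangent at 0; its positivity is what penalizes having fewer than m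
angles. It reduces to y < tan y. -/
lemma sin_sq_sub_pos {y : ℝ} (hy : 0 < y) (hy' : y ≤ π / 3) :
    0 < sin y ^ 2 / y - (2 * sin y * cos y / y - sin y ^ 2 / y ^ 2) * y := by
  have hpi := pi_pos
  have hs := sin_pos_of_pos_of_lt_pi hy (by linarith)
  have hc := cos_pos_of_mem_Ioo ⟨by linarith, by linarith⟩ (x := y)
  have ht := lt_tan hy (by linarith)
  rw [tan_eq_sin_div_cos, lt_div_iff₀ hc] at ht
  have : sin y ^ 2 / y - (2 * sin y * cos y / y - sin y ^ 2 / y ^ 2) * y =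
      2 * sin y * (sin y - y * cos y) / y := by field_simp; ring
  rw [this]
  have : 0 < sin y - y * cos y := by linarith
  positivity

/-- Among `n ≤ m` angles with sum `π`, the sum of `sin² α / α` is largest for `m` equal ones. -/
theorem sum_sin_sq_div_le {n m : ℕ} (hm : 3 ≤ m) (hnm : n ≤ m) {α : ℕ → ℝ}
    (hpos : ∀ i, 0 < α i) (hsum : ∑ i ∈ Finset.range n, α i = π) :
    π * ∑ i ∈ Finset.range n, sin (α i) ^ 2 / α i ≤ (m * sin (π / m)) ^ 2 ∧
    (π * ∑ i ∈ Finset.range n, sin (α i) ^ 2 / α i = (m * sin (π / m)) ^ 2 →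
      n = m ∧ ∀ i < n, α i = π / m) := by
  have hpi := pi_pos
  have hm3 : (3 : ℝ) ≤ m := by exact_mod_cast hm
  have hm0 : (0 : ℝ) < m := by linarith
  set y := π / m with hy
  have y0 : 0 < y := by positivity
  have y3 : y ≤ π / 3 := div_le_div_of_nonneg_left hpi.le (by norm_num) hm3
  set b := 2 * sin y * cos y / y - sin y ^ 2 / y ^ 2 with hb
  set c := sin y ^ 2 / y - b * y with hc
  have c0 : 0 < c := sin_sq_sub_pos y0 y3
  have htan : ∀ x, 0 < x → sin x ^ 2 / x ≤ c + b * x := by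
    intro x x0
    rcases eq_or_ne x y with rfl | hne
    · rw [hc]; linarith
    · have := sin_sq_div_lt_tangent x0 y0 y3 hne
      rw [hc]; linarith
  have hval : (m * sin y) ^ 2 = π * (m * c + b * π) := by
    have e : m * y = π := by rw [hy]; field_simp
    rw [hc, ← e]; field_simp; ring
  have hs : ∑ i ∈ Finset.range n, (c + b * α i) = n * c + b * π := by
    rw [Finset.sum_add_distrib, ← Finset.mul_sum, hsum]; simp
  have h1 : ∑ i ∈ Finset.range n, sin (α i) ^ 2 / α i ≤ n * c + b * π := by
    rw [← hs]
    exact Finset.sum_le_sum fun i _ => htan _ (hpos i)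
  have hnm' : (n : ℝ) ≤ m := by exact_mod_cast hnm
  have h2 : n * c + b * π ≤ m * c + b * π := by
    have := mul_le_mul_of_nonneg_right hnm' c0.le
    linarith
  refine ⟨?_, fun heq => ?_⟩
  · rw [hval]
    exact mul_le_mul_of_nonneg_left (h1.trans h2) hpi.le
  · rw [hval] at heq
    have heq := mul_left_cancel₀ hpi.ne' heq
    have e1 : n * c + b * π = m * c + b * π := le_antisymm h2 (by rw [← heq]; exact h1)
    have hnm'' : (n : ℝ) = m := mul_right_cancel₀ c0.ne' (by linarith)
    refine ⟨by exact_mod_cast hnm'', fun i hi => ?_⟩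
    by_contra hne
    have hlt' : ∑ i ∈ Finset.range n, sin (α i) ^ 2 / α i < ∑ i ∈ Finset.range n, (c + b * α i) :=
      Finset.sum_lt_sum (fun i _ => htan _ (hpos i)) ⟨i, Finset.mem_range.2 hi, by
        have := sin_sq_div_lt_tangent (hpos i) y0 y3 hne
        rw [hc]; linarith⟩
    rw [hs] at hlt'
    linarith

/-! ### The upper bound for a convex polygon. -/

namespace ConvexPolygon

variable {n : ℕ} {p : ℕ → Plane} {z : Plane}

lemma re_circlePoint (n : ℕ) (p : ℕ → Plane) (z : Plane) (k : ℕ) :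
    (circlePoint n p z k).re = cos (2 * π * phase n p z k) := Complex.exp_ofReal_mul_I_re _

lemma im_circlePoint (n : ℕ) (p : ℕ → Plane) (z : Plane) (k : ℕ) :
    (circlePoint n p z k).im = sin (2 * π * phase n p z k) := Complex.exp_ofReal_mul_I_im _

/-- On the unit circle cos² + sin² = 1 collapses the potential term, and neighboring points subtend
the angle 2π a_i / S, whose cosine is 1 - 2 sin²(π a_i / S). -/
lemma mixedArea_circlePoint (h : ConvexPolygon n p) (z : Plane) :
    mixedArea n p z (fun k => (circlePoint n p z k).re) (fun k => (circlePoint n p z k).re) +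
      mixedArea n p z (fun k => (circlePoint n p z k).im) (fun k => (circlePoint n p z k).im) =
    polarDoubleArea n p z -
      ∑ i ∈ Finset.range n, 4 * sin (π * (edgeArea p z i / doubleArea n p)) ^ 2 /
        edgeArea p z i := by
  have hre : Function.Periodic (fun k => (circlePoint n p z k).re) n := fun k => by
    simp only [h.periodic_circlePoint z k]
  have him : Function.Periodic (fun k => (circlePoint n p z k).im) n := fun k => by
    simp only [h.periodic_circlePoint z k]
  rw [h.mixedArea_eq hre hre, h.mixedArea_eq him him, ← Finset.sum_add_distrib]
  have hs := sum_range_shift (f := fun i => 1 / edgeArea p z i) (n := n)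
    (fun i => by simp only [h.periodic_edgeArea z i])
  have e : ∀ i, ((circlePoint n p z i).re * (circlePoint n p z (i + 1)).re +
        (circlePoint n p z (i + 1)).re * (circlePoint n p z i).re) / edgeArea p z i -
        potential p z i * ((circlePoint n p z (i + 1)).re * (circlePoint n p z (i + 1)).re) +
      (((circlePoint n p z i).im * (circlePoint n p z (i + 1)).im +
        (circlePoint n p z (i + 1)).im * (circlePoint n p z i).im) / edgeArea p z i -
        potential p z i * ((circlePoint n p z (i + 1)).im * (circlePoint n p z (i + 1)).im)) =
      (dualWeight p z i - 4 * sin (π * (edgeArea p z i / doubleArea n p)) ^ 2 / edgeArea p z i)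
        + 1 / edgeArea p z i - 1 / edgeArea p z (i + 1) := by
    intro i
    simp only [re_circlePoint, im_circlePoint]
    have hcos : cos (2 * π * phase n p z (i + 1)) * cos (2 * π * phase n p z i) +
        sin (2 * π * phase n p z (i + 1)) * sin (2 * π * phase n p z i) =
        1 - 2 * sin (π * (edgeArea p z i / doubleArea n p)) ^ 2 := by
      rw [← cos_sub, phase_succ,
        show 2 * π * (phase n p z i + edgeArea p z i / doubleArea n p) - 2 * π * phase n p z i =
          2 * (π * (edgeArea p z i / doubleArea n p)) by ring, cos_two_mul, cos_sq']
      ring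
    have hsq := sin_sq_add_cos_sq (2 * π * phase n p z (i + 1))
    unfold potential
    linear_combination 2 / edgeArea p z i * hcos -
      (1 / edgeArea p z i + 1 / edgeArea p z (i + 1) - dualWeight p z i) * hsq
  simp only [e, Finset.sum_sub_distrib, Finset.sum_add_distrib, hs, polarDoubleArea, dualWeight]
  ring

/-- The upper bound for the volume product of a convex polygon, with its equality case. -/
theorem exists_center (h : ConvexPolygon n p) {m : ℕ} (hnm : n ≤ m) :
    ∃ z, (∀ i, 0 < edgeArea p z i) ∧
      doubleArea n p / 2 * (polarDoubleArea n p z / 2) ≤ (m * sin (π / m)) ^ 2 ∧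
      (doubleArea n p / 2 * (polarDoubleArea n p z / 2) = (m * sin (π / m)) ^ 2 →
        n = m ∧ ∃ ξ η : Plane, ∀ i ≤ n, cos (2 * i * π / m) = inner ℝ ξ (p i - z) ∧
          sin (2 * i * π / m) = inner ℝ η (p i - z)) := by
  obtain ⟨z, hz, hbal⟩ := h.exists_balanced
  refine ⟨z, hz, ?_⟩
  have hpi := pi_pos
  have h3 := h.three_le
  have hS := h.doubleArea_pos
  set S := doubleArea n p with hSdef
  have hsumS : ∑ i ∈ Finset.range n, edgeArea p z i = S := h.sum_edgeArea z
  have hre : Function.Periodic (fun k => (circlePoint n p z k).re) n := fun k => by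
    simp only [h.periodic_circlePoint z k]
  have him : Function.Periodic (fun k => (circlePoint n p z k).im) n := fun k => by
    simp only [h.periodic_circlePoint z k]
  -- Balancedness is exactly orthogonality of both coordinates to the constant 1.
  have bre : mixedArea n p z (fun _ => 1) (fun k => (circlePoint n p z k).re) = 0 := by
    have := congrArg Complex.re hbal
    rw [Complex.re_sum] at this
    simp only [Complex.re_ofReal_mul, Complex.zero_re] at this
    rw [← this]
    exact Finset.sum_congr rfl fun i _ => by rw [jacobi_one, mul_comm]
  have bim : mixedArea n p z (fun _ => 1) (fun k => (circlePoint n p z k).im) = 0 := by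
    have := congrArg Complex.im hbal
    rw [Complex.im_sum] at this
    simp only [Complex.im_ofReal_mul, Complex.zero_im] at this
    rw [← this]
    exact Finset.sum_congr rfl fun i _ => by rw [jacobi_one, mul_comm]
  have n1 := h.mixedArea_self_nonpos hz hre bre
  have n2 := h.mixedArea_self_nonpos hz him bim
  have hT := h.mixedArea_circlePoint z
  set α : ℕ → ℝ := fun i => π * (edgeArea p z i / S) with hα
  have hαpos : ∀ i, 0 < α i := fun i => mul_pos hpi (div_pos (hz i) hS)
  have hαsum : ∑ i ∈ Finset.range n, α i = π := by
    simp only [α]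
    rw [← Finset.mul_sum, ← Finset.sum_div, hsumS, div_self hS.ne', mul_one]
  obtain ⟨s1, s2⟩ := sum_sin_sq_div_le (by omega) hnm hαpos hαsum
  have hconv : S / 2 * ((∑ i ∈ Finset.range n, 4 * sin (π * (edgeArea p z i / S)) ^ 2 /
        edgeArea p z i) / 2) = π * ∑ i ∈ Finset.range n, sin (α i) ^ 2 / α i := by
    rw [Finset.sum_div, Finset.mul_sum, Finset.mul_sum]
    refine Finset.sum_congr rfl fun i _ => ?_
    have := (hz i).ne'
    simp only [α]
    field_simp
    ring
  have hle : S / 2 * (polarDoubleArea n p z / 2) ≤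
      π * ∑ i ∈ Finset.range n, sin (α i) ^ 2 / α i := by
    rw [← hconv]
    exact mul_le_mul_of_nonneg_left (by linarith) (by positivity)
  refine ⟨hle.trans s1, fun heq => ?_⟩
  obtain ⟨rfl, hα'⟩ := s2 (le_antisymm s1 (heq ▸ hle))
  refine ⟨rfl, ?_⟩
  have hTeq : polarDoubleArea n p z / 2 = (∑ i ∈ Finset.range n,
      4 * sin (π * (edgeArea p z i / S)) ^ 2 / edgeArea p z i) / 2 := by
    apply mul_left_cancel₀ (half_pos hS).ne'
    rw [hconv]
    exact le_antisymm hle (heq ▸ s1)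
  obtain ⟨ξ, hξ⟩ := h.exists_eq_inner_of_mixedArea_eq_zero hz hre bre (by linarith)
  obtain ⟨η, hη⟩ := h.exists_eq_inner_of_mixedArea_eq_zero hz him bim (by linarith)
  have hn0 : (n : ℝ) ≠ 0 := by exact_mod_cast h.pos.ne'
  have hph : ∀ k ≤ n, phase n p z k = k / n := by
    intro k hk
    have : ∀ i ∈ Finset.range k, edgeArea p z i = S / n := by
      intro i hi
      have := hα' i (by have := Finset.mem_range.1 hi; omega)
      simp only [α] at this
      rw [div_eq_mul_inv π] at this
      have := mul_left_cancel₀ hpi.ne' this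
      rw [div_eq_iff hS.ne'] at this
      rw [this]; ring
    rw [phase, Finset.sum_congr rfl this, ← hSdef]
    simp only [Finset.sum_const, Finset.card_range, nsmul_eq_mul]
    field_simp
  refine ⟨ξ, η, fun i hi => ⟨?_, ?_⟩⟩
  · rw [← hξ i, re_circlePoint, hph i hi]; congr 1; ring
  · rw [← hη i, im_circlePoint, hph i hi]; congr 1; ring

end ConvexPolygon
end VolumeProduct

end TangentLine

/-! ### Counterclockwise enumeration of the vertices of a polytope. -/

namespace VolumeProduct

lemma ne_zero_of_inner_pos {a b : Plane} (h : 0 < inner ℝ a b) : 0 < a 0 ^ 2 + a 1 ^ 2 := by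
  by_contra hc
  have h0 := sq_nonneg (a 0)
  have h1 := sq_nonneg (a 1)
  have e0 : a 0 = 0 := pow_eq_zero_iff (n := 2) (by norm_num) |>.1 (by linarith)
  have e1 : a 1 = 0 := pow_eq_zero_iff (n := 2) (by norm_num) |>.1 (by linarith)
  rw [inner_eq, e0, e1] at h
  simp at h

/-- Every extreme point has a counterclockwise successor: all other extreme points lie strictly to
the left of the edge leading to it. -/
lemma exists_successor {V : Set Plane} (hfin : V.Finite)
    (hV : (convexHull ℝ V).extremePoints ℝ = V) {x : Plane} (hx : x ∈ V)
    (hne : (V \ {x}).Nonempty) :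
    ∃ y ∈ V, y ≠ x ∧ ∀ r ∈ V, r ≠ x → r ≠ y → 0 < cross (y - x) (r - x) := by
  have hK := convex_convexHull ℝ V
  have hmem : ∀ {y}, y ∈ V → y ∈ convexHull ℝ V := fun hy => subset_convexHull ℝ V hy
  have hxe : x ∉ convexHull ℝ (V \ {x}) := by
    rw [← hV] at hx
    have := (hK.mem_extremePoints_iff_mem_sdiff_convexHull_sdiff.1 hx).2
    exact fun h => this (convexHull_mono (Set.sdiff_subset_sdiff_left (subset_convexHull ℝ V)) h)
  obtain ⟨f, u, hfx, hf⟩ := geometric_hahn_banach_point_closed (convex_convexHull ℝ (V \ {x}))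
    ((hfin.subset Set.sdiff_subset).isClosed_convexHull ℝ) hxe
  set ν : Plane := (InnerProductSpace.toDual ℝ Plane).symm f
  have hν : ∀ d, inner ℝ ν d = f d := fun d => InnerProductSpace.toDual_symm_apply
  have hpos : ∀ r ∈ V, r ≠ x → 0 < inner ℝ ν (r - x) := by
    intro r hr hrx
    have := hf r (subset_convexHull ℝ _ ⟨hr, hrx⟩)
    rw [hν, map_sub]; linarith
  -- All other points lie in an open half-plane at `x` with inner normal `ν`; the quotient is the
  -- tangent of the angle from `ν`, so `y` is the most clockwise point.
  obtain ⟨y, ⟨hyV, hyx⟩, hmin⟩ := Set.exists_min_image (V \ {x})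
    (fun r => cross ν (r - x) / inner ℝ ν (r - x)) (hfin.subset Set.sdiff_subset) hne
  refine ⟨y, hyV, hyx, fun r hr hrx hry => ?_⟩
  have py := hpos y hyV hyx
  have pr := hpos r hr hrx
  have hle := hmin r ⟨hr, hrx⟩
  rw [div_le_div_iff₀ py pr] at hle
  have hn := ne_zero_of_inner_pos py
  have hid : (ν 0 ^ 2 + ν 1 ^ 2) * cross (y - x) (r - x) =
      cross ν (r - x) * inner ℝ ν (y - x) - cross ν (y - x) * inner ℝ ν (r - x) := by
    simp only [cross, inner_eq]; ring
  have hge : 0 ≤ cross (y - x) (r - x) := by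
    by_contra hc
    have := mul_neg_of_pos_of_neg hn (not_le.1 hc)
    linarith
  refine lt_of_le_of_ne hge fun h0 => ?_
  -- otherwise `x, y, r` are collinear, and one of them is not extreme
  have hvec : inner ℝ ν (y - x) • (r - x) = inner ℝ ν (r - x) • (y - x) := by
    have h0' := h0.symm
    simp only [cross] at h0'
    apply plane_ext
    · simp only [PiLp.smul_apply, smul_eq_mul, inner_eq]
      linear_combination (-ν 1) * h0'
    · simp only [PiLp.smul_apply, smul_eq_mul, inner_eq]
      linear_combination (ν 0) * h0'
  have hext : ∀ a ∈ V, ∀ b ∈ V, ∀ c ∈ V, c ∈ openSegment ℝ a b → a = c ∧ b = c := by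
    intro a ha b hb c hc h
    rw [← hV] at hc
    exact (mem_extremePoints.1 hc).2 a (hmem ha) b (hmem hb) h
  rcases lt_trichotomy (inner ℝ ν (r - x)) (inner ℝ ν (y - x)) with h | h | h
  · refine hrx (hext x hx y hyV r hr ?_).1.symm
    refine ⟨1 - inner ℝ ν (r - x) / inner ℝ ν (y - x), inner ℝ ν (r - x) / inner ℝ ν (y - x),
      by rw [sub_pos, div_lt_one py]; exact h, div_pos pr py, by ring, ?_⟩
    have : r - x = (inner ℝ ν (r - x) / inner ℝ ν (y - x)) • (y - x) := by
      rw [div_eq_inv_mul, mul_smul, ← hvec, smul_smul, inv_mul_cancel₀ py.ne', one_smul]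
    set t := inner ℝ ν (r - x) / inner ℝ ν (y - x)
    rw [← sub_add_cancel r x, this]
    module
  · rw [h] at hvec
    exact hry (sub_left_injective (smul_right_injective _ py.ne' hvec))
  · refine hyx (hext x hx r hr y hyV ?_).1.symm
    refine ⟨1 - inner ℝ ν (y - x) / inner ℝ ν (r - x), inner ℝ ν (y - x) / inner ℝ ν (r - x),
      by rw [sub_pos, div_lt_one pr]; exact h, div_pos py pr, by ring, ?_⟩
    have : y - x = (inner ℝ ν (y - x) / inner ℝ ν (r - x)) • (r - x) := by
      rw [div_eq_inv_mul, mul_smul, hvec, smul_smul, inv_mul_cancel₀ pr.ne', one_smul]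
    set t := inner ℝ ν (y - x) / inner ℝ ν (r - x)
    rw [← sub_add_cancel y x, this]
    module

lemma convexHull_extremePoints_of_finite {S : Set Plane} (hS : S.Finite) :
    convexHull ℝ ((convexHull ℝ S).extremePoints ℝ) = convexHull ℝ S := by
  have := closure_convexHull_extremePoints (hS.isCompact_convexHull ℝ) (convex_convexHull ℝ S)
  rwa [((hS.subset extremePoints_convexHull_subset).isClosed_convexHull ℝ).closure_eq] at this

/-- The extreme points of a planar polytope can be enumerated counterclockwise. -/
theorem IsPolytopeWithAtMost.exists_convexPolygon {m : ℕ} {K : Set Plane}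
    (hK : IsPolytopeWithAtMost m K) :
    ∃ (n : ℕ) (p : ℕ → Plane), n ≤ m ∧ ConvexPolygon n p ∧ K = convexHull ℝ (Set.range p) := by
  obtain ⟨S, hS, rfl⟩ := hK.exists_eq_convexHull
  obtain ⟨z, hz⟩ := hK.interior_nonempty
  have hcard := hK.encard_vertices_le
  set V := (convexHull ℝ S).extremePoints ℝ with hVdef
  have hVfin : V.Finite := hS.subset extremePoints_convexHull_subset
  have hVK : convexHull ℝ V = convexHull ℝ S := convexHull_extremePoints_of_finite hS
  have hVV : (convexHull ℝ V).extremePoints ℝ = V := by rw [hVK]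
  rw [← hVK] at hz ⊢
  have hVne : V.Nonempty := by
    rw [← convexHull_nonempty_iff (𝕜 := ℝ)]
    exact ⟨z, interior_subset hz⟩
  have hne : ∀ x, (V \ {x}).Nonempty := by
    intro x
    by_contra hc
    rw [Set.not_nonempty_iff_eq_empty, Set.sdiff_eq_empty] at hc
    have hsub : convexHull ℝ V ⊆ {x} := convexHull_min hc (convex_singleton x)
    have := interior_mono hsub hz
    rw [interior_singleton] at this
    exact this
  choose! σ hσV hσne hσ using fun x (hx : x ∈ V) => exists_successor hVfin hVV hx (hne x)
  have hleft : ∀ x ∈ V, ∀ r ∈ convexHull ℝ V, 0 ≤ cross (σ x - x) (r - x) := by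
    intro x hx r hr
    have hc : Convex ℝ {r | 0 ≤ cross (σ x - x) (r - x)} := by
      intro a ha b hb s t hs ht hst
      simp only [Set.mem_ofPred_eq] at *
      have : cross (σ x - x) (s • a + t • b - x) =
          s * cross (σ x - x) (a - x) + t * cross (σ x - x) (b - x) := by
        obtain rfl : t = 1 - s := by linarith
        simp [cross]; ring
      rw [this]; positivity
    refine convexHull_min (fun r hr => ?_) hc hr
    simp only [Set.mem_ofPred_eq]
    rcases eq_or_ne r x with rfl | h1
    · simp [cross]
    rcases eq_or_ne r (σ x) with rfl | h2
    · unfold cross; linarith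
    · exact (hσ x hx r hr h1 h2).le
  have hzleft : ∀ x ∈ V, 0 < cross (σ x - x) (z - x) := fun x hx =>
    cross_pos_of_mem_interior (sub_ne_zero.2 (hσne x hx)) (hleft x hx) hz
  set τ : V → V := fun x => ⟨σ x, hσV x x.2⟩
  -- Two points with a common successor would each lie strictly to the left of the edge from the
  -- other, which gives opposite signs.
  have hτinj : Function.Injective τ := by
    rintro ⟨x, hx⟩ ⟨y, hy⟩ hxy
    have hxy : σ x = σ y := congrArg Subtype.val hxy
    by_contra hne
    have hne : x ≠ y := fun h => hne (Subtype.ext h)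
    have h1 := hσ x hx y hy hne.symm (by rw [hxy]; exact (hσne y hy).symm)
    have h2 := hσ y hy x hx hne (by rw [← hxy]; exact (hσne x hx).symm)
    rw [← hxy] at h2
    have : cross (σ x - y) (x - y) = - cross (σ x - x) (y - x) := by
      simp [cross]; ring
    linarith
  obtain ⟨x₀, hx₀⟩ := hVne
  have : Finite V := hVfin
  have hper := hτinj.mem_periodicPts ⟨x₀, hx₀⟩
  set n := Function.minimalPeriod τ ⟨x₀, hx₀⟩ with hn
  have hn0 : 0 < n := Function.minimalPeriod_pos_of_mem_periodicPts hper
  have hnper : τ^[n] ⟨x₀, hx₀⟩ = ⟨x₀, hx₀⟩ := Function.isPeriodicPt_minimalPeriod τ _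
  set q : ℕ → Plane := fun i => (τ^[i] ⟨x₀, hx₀⟩ : V) with hq
  have hqV : ∀ i, q i ∈ V := fun i => (τ^[i] ⟨x₀, hx₀⟩).2
  have hqs : ∀ i, q (i + 1) = σ (q i) := fun i => by
    simp only [q, Function.iterate_succ_apply']; rfl
  have hqne : ∀ i j, i < j → j < i + n → q j ≠ q i := by
    intro i j hij hjn h
    have h := Subtype.ext h
    obtain ⟨d, rfl⟩ : ∃ d, j = i + d := ⟨j - i, by omega⟩
    rw [Function.iterate_add_apply] at h
    have := Nat.le_of_dvd (by omega)
      (Function.IsPeriodicPt.minimalPeriod_dvd (hτinj.iterate i h))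
    omega
  -- A cycle of length 2 would put `z` strictly on both sides of one line.
  have hn3 : 3 ≤ n := by
    by_contra hlt
    have hq0 : q n = q 0 := congrArg Subtype.val hnper
    obtain h1 | h1 : n = 1 ∨ n = 2 := by omega
    · rw [h1, hqs 0] at hq0
      exact hσne _ (hqV 0) hq0
    · have a := hzleft _ (hqV 0)
      have b := hzleft _ (hqV 1)
      rw [← hqs] at a b
      rw [h1] at hq0
      simp only [zero_add, Nat.reduceAdd] at a b
      rw [hq0] at b
      have : cross (q 0 - q 1) (z - q 1) = - cross (q 1 - q 0) (z - q 0) := by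
        simp [cross]; ring
      linarith
  have hpoly : ConvexPolygon n q :=
    { periodic := fun i => by
        simp only [q]; rw [Function.iterate_add_apply, hnper]
      three_le := hn3
      cross_pos := fun i j h1 h2 => by
        rw [hqs]
        refine hσ _ (hqV i) _ (hqV j) (hqne i j (by omega) h2) ?_
        rw [← hqs]
        exact hqne (i + 1) j h1 (by omega) }
  have hzq : ∀ i, 0 < edgeArea q z i := fun i => by
    rw [edgeArea_eq, hqs]; exact hzleft _ (hqV i)
  have hzV : z ∉ V := fun h => by
    have := hzleft z h
    rw [sub_self] at this
    simp [cross] at this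
  -- A single orbit exhausts `V`: each `r ∈ V` lies in a triangle with vertices `z`, `q i`, `q (i +
  -- 1)`; being extreme, it is one of them, and it is not `z`.
  have hVq : V = Set.range q := by
    apply Set.Subset.antisymm
    · intro r hr
      obtain ⟨i, -, s, t, hs, ht, e⟩ := (hpoly.dualFan hzq).exists_mem_cone (r - z)
      have h1 : s + t ≤ 1 := by
        rw [← (hpoly.dualFan hzq).inner_combo i s t, ← e,
          ConvexPolygon.inner_dualVertex_eq hzq]
        have : 0 ≤ edgeArea q r i := by
          rw [edgeArea_eq, hqs]; exact hleft _ (hqV i) r (subset_convexHull ℝ V hr)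
        have := div_nonneg this (hzq i).le
        linarith
      have hmem : r ∈ convexHull ℝ {z, q i, q (i + 1)} := by
        have := (convex_convexHull ℝ {z, q i, q (i + 1)}).sum_mem (t := Finset.univ)
          (w := ![1 - s - t, s, t]) (z := ![z, q i, q (i + 1)])
          (by intro k _; fin_cases k <;> simp <;> linarith)
          (by simp [Fin.sum_univ_three]; ring)
          (by intro k _; fin_cases k <;> exact subset_convexHull ℝ _ (by simp))
        convert this using 1
        simp only [Fin.sum_univ_three, Matrix.cons_val_zero, Matrix.cons_val_one, Matrix.cons_val]
        rw [← sub_add_cancel r z, e]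
        module
      have hsub : convexHull ℝ {z, q i, q (i + 1)} ⊆ convexHull ℝ V := by
        apply convexHull_min _ (convex_convexHull ℝ V)
        rintro _ (rfl | rfl | rfl)
        · exact interior_subset hz
        · exact subset_convexHull ℝ V (hqV i)
        · exact subset_convexHull ℝ V (hqV (i + 1))
      have hr' : r ∈ (convexHull ℝ V).extremePoints ℝ := by rw [hVV]; exact hr
      have := extremePoints_convexHull_subset
        (inter_extremePoints_subset_extremePoints_of_subset hsub ⟨hmem, hr'⟩)
      rcases this with rfl | rfl | rfl
      · exact absurd hr hzV
      · exact ⟨i, rfl⟩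
      · exact ⟨i + 1, rfl⟩
    · rintro _ ⟨i, rfl⟩
      exact hqV i
  refine ⟨n, q, ?_, hpoly, by rw [hVq]⟩
  have hinj : Set.InjOn q (Finset.range n : Set ℕ) := by
    intro i hi j hj hij
    simp only [Finset.coe_range, Set.mem_Iio] at hi hj
    by_contra hne
    rcases lt_or_gt_of_ne hne with h | h
    · exact hqne i j h (by omega) hij.symm
    · exact hqne j i h (by omega) hij
  have hle : (q '' (Finset.range n : Set ℕ)).encard ≤ V.encard :=
    Set.encard_le_encard (by rintro _ ⟨i, -, rfl⟩; exact hqV i)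
  rw [hinj.encard_image, Set.encard_coe_eq_coe_finsetCard, Finset.card_range] at hle
  exact_mod_cast hle.trans hcard

end VolumeProduct

/-! ### Affine invariance. -/

namespace VolumeProduct

lemma volumeProduct_affine_image_le (A : Plane ≃ᵃ[ℝ] Plane) (K : Set Plane) :
    volumeProduct (A '' K) ≤ volumeProduct K := by
  refine le_iInf₂ fun z hz => ?_
  have hAz : A z ∈ interior (A '' K) := by
    have : A '' interior K = interior (A '' K) :=
      (AffineEquiv.toContinuousAffineEquiv A).toHomeomorph.image_interior K
    rw [← this]
    exact ⟨z, hz, rfl⟩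
  refine (iInf₂_le (A z) hAz).trans (le_of_eq ?_)
  set L : Plane →ₗ[ℝ] Plane := (A.linear : Plane →ₗ[ℝ] Plane)
  have hL : ∀ x y, A x - A y = L (x - y) := fun x y => (A.toAffineMap.linearMap_vsub x y).symm
  have hdet : LinearMap.det L ≠ 0 := A.linear.isUnit_det'.ne_zero
  have h1 : volume (A '' K) = ENNReal.ofReal |LinearMap.det L| * volume K := by
    rw [← Measure.addHaar_image_linearMap, ← volume_image_sub _ (A 0), Set.image_image]
    congr 2
    ext x
    rw [hL, sub_zero]
  -- After centering, the polar of the image is the preimage of the polar under the adjoint of `L`,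
  -- so the two determinants cancel.
  have h2 : volume (polarBody (A '' K) (A z)) =
      ENNReal.ofReal |(LinearMap.det L)⁻¹| * volume (polarBody K z) := by
    have hadj : LinearMap.det (LinearMap.adjoint L) = LinearMap.det L := by
      rw [← LinearMap.det_toMatrix (EuclideanSpace.basisFun (Fin 2) ℝ).toBasis,
        LinearMap.toMatrix_adjoint, Matrix.det_conjTranspose, LinearMap.det_toMatrix, star_trivial]
    rw [← volume_image_sub _ (A z), ← volume_image_sub (polarBody K z) z, ← hadj,
      ← Measure.addHaar_preimage_linearMap _ (by rw [hadj]; exact hdet)]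
    congr 1
    ext y
    simp only [Set.mem_image, Set.mem_preimage]
    constructor
    · rintro ⟨y, hy, rfl⟩
      refine ⟨LinearMap.adjoint L (y - A z) + z, fun x hx => ?_, add_sub_cancel_right _ _⟩
      rw [add_sub_cancel_right, LinearMap.adjoint_inner_left, ← hL]
      exact hy _ ⟨x, hx, rfl⟩
    · rintro ⟨x, hx, e⟩
      refine ⟨y + A z, ?_, add_sub_cancel_right _ _⟩
      rintro _ ⟨k, hk, rfl⟩
      rw [add_sub_cancel_right, hL, ← LinearMap.adjoint_inner_left, ← e]
      exact hx k hk
  rw [h1, h2, mul_mul_mul_comm, ← ENNReal.ofReal_mul (abs_nonneg _), ← abs_mul,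
    mul_inv_cancel₀ hdet, abs_one, ENNReal.ofReal_one, one_mul]

/-- The volume product is affinely invariant. -/
theorem volumeProduct_affine_image (A : Plane ≃ᵃ[ℝ] Plane) (K : Set Plane) :
    volumeProduct (A '' K) = volumeProduct K := by
  refine le_antisymm (volumeProduct_affine_image_le A K) ?_
  have := volumeProduct_affine_image_le A.symm (A '' K)
  rwa [Set.image_image, show (fun x => A.symm (A x)) = id from funext A.symm_apply_apply,
    Set.image_id] at this

/-! ### The regular polygon. -/

/-- The vertices of the regular `m`-gon. -/
noncomputable def regularVertex (m k : ℕ) : Plane :=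
  !₂[Real.cos (2 * (k : ℝ) * Real.pi / (m : ℝ)), Real.sin (2 * (k : ℝ) * Real.pi / (m : ℝ))]

lemma periodic_regularVertex {m : ℕ} (hm : 0 < m) : Function.Periodic (regularVertex m) m := by
  intro k
  have hm' : (m : ℝ) ≠ 0 := by exact_mod_cast hm.ne'
  have e : 2 * ((k + m : ℕ) : ℝ) * Real.pi / m = 2 * k * Real.pi / m + 2 * Real.pi := by
    push_cast; field_simp
  unfold regularVertex
  rw [e, Real.cos_add_two_pi, Real.sin_add_two_pi]

lemma range_eq_of_periodic {p : ℕ → Plane} {n : ℕ} (hp : Function.Periodic p n) (hn : 0 < n) :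
    Set.range p = {v | ∃ k : ℕ, k < n ∧ v = p k} := by
  ext v
  constructor
  · rintro ⟨k, rfl⟩
    exact ⟨k % n, Nat.mod_lt _ hn, (hp.map_mod_nat k).symm⟩
  · rintro ⟨k, -, rfl⟩
    exact ⟨k, rfl⟩

lemma regularPolygon_eq {m : ℕ} (hm : 0 < m) :
    regularPolygon m = convexHull ℝ (Set.range (regularVertex m)) := by
  rw [range_eq_of_periodic (periodic_regularVertex hm) hm]; rfl

/-- Twice the signed area of a triangle inscribed in the unit circle, in terms of half the central
angles. -/
lemma cross_chord (a x y : ℝ) :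
    cross (!₂[Real.cos (a + 2 * x), Real.sin (a + 2 * x)] - !₂[Real.cos a, Real.sin a])
      (!₂[Real.cos (a + 2 * x + 2 * y), Real.sin (a + 2 * x + 2 * y)] -
        !₂[Real.cos a, Real.sin a]) = 4 * Real.sin x * Real.sin y * Real.sin (x + y) := by
  have e1 : Real.sin (2 * x) = Real.sin ((a + 2 * x) - a) := by congr 1; ring
  have e2 : Real.sin (2 * y) = Real.sin ((a + 2 * x + 2 * y) - (a + 2 * x)) := by congr 1; ring
  have e3 : Real.sin (2 * (x + y)) = Real.sin ((a + 2 * x + 2 * y) - a) := by congr 1; ring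
  have h : 4 * Real.sin x * Real.sin y * Real.sin (x + y) =
      Real.sin (2 * x) + Real.sin (2 * y) - Real.sin (2 * (x + y)) := by
    rw [Real.sin_two_mul, Real.sin_two_mul, Real.sin_two_mul, Real.sin_add, Real.cos_add]
    linear_combination (2 * Real.sin x * Real.cos x) * Real.sin_sq_add_cos_sq y +
      (2 * Real.sin y * Real.cos y) * Real.sin_sq_add_cos_sq x
  rw [h, e1, e2, e3, Real.sin_sub, Real.sin_sub, Real.sin_sub]
  simp [cross]
  ring

lemma cross_regularVertex {m : ℕ} (i d : ℕ) :
    cross (regularVertex m (i + 1) - regularVertex m i)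
      (regularVertex m (i + 1 + d) - regularVertex m i) =
    4 * Real.sin (Real.pi / m) * Real.sin (d * (Real.pi / m)) *
      Real.sin ((d + 1) * (Real.pi / m)) := by
  have := cross_chord (2 * i * Real.pi / m) (Real.pi / m) (d * (Real.pi / m))
  rw [show (d + 1 : ℝ) * (Real.pi / m) = Real.pi / m + d * (Real.pi / m) by ring, ← this]
  unfold regularVertex
  push_cast
  congr 4 <;> ring_nf

lemma convexPolygon_regularVertex {m : ℕ} (hm : 3 ≤ m) : ConvexPolygon m (regularVertex m) where
  periodic := periodic_regularVertex (by omega)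
  three_le := hm
  cross_pos i j h1 h2 := by
    obtain ⟨d, rfl⟩ : ∃ d, j = i + 1 + d := ⟨j - (i + 1), by omega⟩
    rw [cross_regularVertex]
    have hm0 : (0 : ℝ) < m := by exact_mod_cast (by omega : 0 < m)
    have hpi := Real.pi_pos
    have hd0 : (0 : ℝ) < d := by exact_mod_cast (by omega : 0 < d)
    have hdm : (d + 1 : ℝ) < m := by exact_mod_cast (by omega : d + 1 < m)
    have hs : ∀ t : ℝ, 0 < t → t < m → 0 < Real.sin (t * (Real.pi / m)) := fun t t0 t1 => by
      apply Real.sin_pos_of_pos_of_lt_pi (by positivity)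
      rw [mul_div_assoc', div_lt_iff₀ hm0, mul_comm]
      exact mul_lt_mul_of_pos_left t1 hpi
    have h1 := hs 1 one_pos (by linarith)
    rw [one_mul] at h1
    have h2 := hs d hd0 (by linarith)
    have h3 := hs (d + 1) (by linarith) hdm
    positivity

lemma doubleArea_regularVertex {m : ℕ} :
    doubleArea m (regularVertex m) = m * Real.sin (2 * (Real.pi / m)) := by
  have : ∀ i, cross (regularVertex m i) (regularVertex m (i + 1)) =
      Real.sin (2 * (Real.pi / m)) := by
    intro i
    rw [show 2 * (Real.pi / m) = 2 * ((i + 1 : ℕ) : ℝ) * Real.pi / m - 2 * i * Real.pi / m by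
      push_cast; ring, Real.sin_sub]
    simp [cross, regularVertex]
    ring
  simp [doubleArea, this]

lemma corner_regularVertex {m : ℕ} (i : ℕ) :
    corner (regularVertex m) i = 4 * Real.sin (Real.pi / m) ^ 2 * Real.sin (2 * (Real.pi / m)) := by
  have h := cross_regularVertex (m := m) i 1
  have : corner (regularVertex m) i = cross (regularVertex m (i + 1) - regularVertex m i)
      (regularVertex m (i + 1 + 1) - regularVertex m i) := by
    simp [corner, cross]; ring
  rw [this, h, Nat.cast_one, one_mul, one_add_one_eq_two]
  ring

/-- The left side is the tangent plane at (s, s) of the convex function 1 / (ab). -/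
lemma tangent_le_one_div_mul {a b s : ℝ} (ha : 0 < a) (hb : 0 < b) (hs : 0 < s) :
    (3 * s - a - b) / s ^ 3 ≤ 1 / (a * b) := by
  rw [div_le_div_iff₀ (by positivity) (by positivity), one_mul]
  by_cases hc : 3 * s - a - b ≤ 0
  · have := mul_nonpos_of_nonpos_of_nonneg hc (mul_pos ha hb).le
    have : 0 < s ^ 3 := by positivity
    linarith
  · rw [not_le] at hc
    have h1 : a * b ≤ ((a + b) / 2) ^ 2 := by nlinarith [sq_nonneg (a - b)]
    have h2 : (3 * s - a - b) * (a * b) ≤ (3 * s - a - b) * ((a + b) / 2) ^ 2 :=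
      mul_le_mul_of_nonneg_left h1 hc.le
    have h3 : s ^ 3 - (3 * s - a - b) * ((a + b) / 2) ^ 2 =
      (s - (a + b) / 2) ^ 2 * (s + (a + b)) := by ring
    have h4 : 0 ≤ (s - (a + b) / 2) ^ 2 * (s + (a + b)) := by positivity
    linarith

/-- All corners are equal and the `edgeArea` values have mean s for every `z`; summing the tangent
plane bound leaves a constant, the value at the origin. -/
lemma le_polarDoubleArea_regularVertex {m : ℕ} (hm : 3 ≤ m) {z : Plane}
    (hz : ∀ i, 0 < edgeArea (regularVertex m) z i) :
    (m * Real.sin (Real.pi / m)) ^ 2 ≤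
      doubleArea m (regularVertex m) / 2 * (polarDoubleArea m (regularVertex m) z / 2) := by
  have h := convexPolygon_regularVertex hm
  have hm0 : (0 : ℝ) < m := by exact_mod_cast (by omega : 0 < m)
  have hS := h.doubleArea_pos
  have hsum := h.sum_edgeArea z
  have hshift := sum_range_shift (h.periodic_edgeArea z)
  rw [doubleArea_regularVertex] at hS hsum ⊢
  set s := Real.sin (2 * (Real.pi / m)) with hs
  have s0 : 0 < s := by
    by_contra hc
    have := mul_nonpos_of_nonneg_of_nonpos hm0.le (not_lt.1 hc)
    linarith
  have hT : 4 * Real.sin (Real.pi / m) ^ 2 * s * (m * s / s ^ 3) ≤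
      polarDoubleArea m (regularVertex m) z := by
    have e : m * s / s ^ 3 = ∑ i ∈ Finset.range m,
        (3 * s - edgeArea (regularVertex m) z i - edgeArea (regularVertex m) z (i + 1)) / s ^ 3 := by
      rw [← Finset.sum_div, Finset.sum_sub_distrib, Finset.sum_sub_distrib, hshift, hsum]
      simp only [Finset.sum_const, Finset.card_range, nsmul_eq_mul]
      ring
    rw [e, Finset.mul_sum, polarDoubleArea]
    refine Finset.sum_le_sum fun i _ => ?_
    rw [corner_regularVertex, ← mul_one_div (4 * Real.sin (Real.pi / m) ^ 2 * _)]
    exact mul_le_mul_of_nonneg_left (tangent_le_one_div_mul (hz i) (hz _) s0) (by positivity)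
  calc (m * Real.sin (Real.pi / m)) ^ 2 =
        m * s / 2 * (4 * Real.sin (Real.pi / m) ^ 2 * s * (m * s / s ^ 3) / 2) := by
        field_simp; ring
    _ ≤ _ := mul_le_mul_of_nonneg_left (by linarith) (by positivity)

/-! ### The volume product and the equality case. -/

namespace ConvexPolygon

variable {n : ℕ} {p : ℕ → Plane}

lemma polarDoubleArea_nonneg (h : ConvexPolygon n p) {z : Plane}
    (hz : ∀ i, 0 < edgeArea p z i) : 0 ≤ polarDoubleArea n p z :=
  Finset.sum_nonneg fun i _ => div_nonneg (h.corner_pos i).le (mul_pos (hz i) (hz _)).le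

lemma volumeProduct_le_mul (h : ConvexPolygon n p) {z : Plane} (hz : ∀ i, 0 < edgeArea p z i) :
    volumeProduct (convexHull ℝ (Set.range p)) ≤
      ENNReal.ofReal (doubleArea n p / 2 * (polarDoubleArea n p z / 2)) := by
  rw [ENNReal.ofReal_mul (half_pos h.doubleArea_pos).le]
  exact (iInf₂_le z (h.mem_interior hz)).trans
    (mul_le_mul' (h.volume_hull_le hz) (h.volume_polar_le hz))

lemma volumeProduct_le (h : ConvexPolygon n p) {m : ℕ} (hnm : n ≤ m) :
    volumeProduct (convexHull ℝ (Set.range p)) ≤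
      ENNReal.ofReal ((m * Real.sin (Real.pi / m)) ^ 2) := by
  obtain ⟨z, hz, hle, -⟩ := h.exists_center hnm
  exact (h.volumeProduct_le_mul hz).trans (ENNReal.ofReal_le_ofReal hle)

lemma exists_affineEquiv_of_volumeProduct_eq (h : ConvexPolygon n p) {m : ℕ} (hnm : n ≤ m)
    (heq : volumeProduct (convexHull ℝ (Set.range p)) =
      ENNReal.ofReal ((m * Real.sin (Real.pi / m)) ^ 2)) :
    ∃ A : Plane ≃ᵃ[ℝ] Plane, convexHull ℝ (Set.range p) = A '' regularPolygon m := by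
  obtain ⟨z, hz, hle, hcase⟩ := h.exists_center hnm
  have h1 := h.volumeProduct_le_mul hz
  rw [heq, ENNReal.ofReal_le_ofReal_iff (mul_nonneg (half_pos h.doubleArea_pos).le
    (div_nonneg (h.polarDoubleArea_nonneg hz) zero_le_two))] at h1
  obtain ⟨rfl, ξ, η, hξη⟩ := hcase (le_antisymm hle h1)
  have h3 := h.three_le
  have hn0 : (0 : ℝ) < n := by exact_mod_cast h.pos
  let M : Plane →ₗ[ℝ] Plane :=
    { toFun := fun x => !₂[inner ℝ ξ x, inner ℝ η x]
      map_add' := fun x y => by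
        apply plane_ext <;> simp [inner_add_right]
      map_smul' := fun r x => by
        apply plane_ext <;> simp [inner_smul_right] }
  have hMv : ∀ i ≤ n, M (p i - z) = regularVertex n i := fun i hi => by
    have := hξη i hi
    change !₂[inner ℝ ξ (p i - z), inner ℝ η (p i - z)] = _
    rw [← this.1, ← this.2]; rfl
  -- `M` sends two vectors to the first two vertices of the regular polygon, which are linearly
  -- independent, so `M` is invertible.
  have hdet : cross ξ η ≠ 0 := by
    intro h0
    have e : cross (M (p 0 - z)) (M (p 1 - z)) = cross ξ η * cross (p 0 - z) (p 1 - z) := by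
      rw [cross_mul_cross]
      change inner ℝ ξ (p 0 - z) * inner ℝ η (p 1 - z) -
        inner ℝ η (p 0 - z) * inner ℝ ξ (p 1 - z) = _
      ring
    rw [hMv 0 (by omega), hMv 1 (by omega), h0, zero_mul] at e
    have hs : 0 < Real.sin (2 * Real.pi / n) := by
      have hpi := Real.pi_pos
      have : (3 : ℝ) ≤ n := by exact_mod_cast h3
      apply Real.sin_pos_of_pos_of_lt_pi (by positivity)
      rw [div_lt_iff₀ hn0]
      nlinarith
    simp [cross, regularVertex] at e
    exact hs.ne' e
  have hinj : Function.Injective M := by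
    rw [injective_iff_map_eq_zero]
    intro x hx
    have hx0 : ξ 0 * x 0 + ξ 1 * x 1 = 0 := by
      rw [← inner_eq]; exact congrArg (fun v : Plane => v 0) hx
    have hx1 : η 0 * x 0 + η 1 * x 1 = 0 := by
      rw [← inner_eq]; exact congrArg (fun v : Plane => v 1) hx
    have y0 : cross ξ η * x 0 = 0 := by
      unfold cross; linear_combination η 1 * hx0 - ξ 1 * hx1
    have y1 : cross ξ η * x 1 = 0 := by
      unfold cross; linear_combination ξ 0 * hx1 - η 0 * hx0
    exact plane_ext ((mul_eq_zero.1 y0).resolve_left hdet) ((mul_eq_zero.1 y1).resolve_left hdet)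
  let B : Plane ≃ᵃ[ℝ] Plane := (AffineEquiv.constVAdd ℝ Plane (-z)).trans
    (LinearEquiv.ofInjectiveEndo M hinj).toAffineEquiv
  have hB : ∀ x, B x = M (x - z) := fun x => by
    change M (-z + x) = _
    rw [neg_add_eq_sub]
  have hBp : ∀ i, B (p i) = regularVertex n i := fun i => by
    rw [hB, ← h.periodic.map_mod_nat i, hMv _ (Nat.mod_lt _ h.pos).le,
      (periodic_regularVertex h.pos).map_mod_nat]
  refine ⟨B.symm, ?_⟩
  have himg : B '' convexHull ℝ (Set.range p) = regularPolygon n := by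
    rw [regularPolygon_eq h.pos]
    have := B.toAffineMap.image_convexHull (Set.range p)
    rw [AffineEquiv.coe_toAffineMap] at this
    rw [this, ← Set.range_comp]
    congr 2
    exact funext hBp
  rw [← himg, Set.image_image, show (fun x => B.symm (B x)) = id from funext B.symm_apply_apply,
    Set.image_id]

end ConvexPolygon

theorem volumeProduct_regularPolygon {m : ℕ} (hm : 3 ≤ m) :
    volumeProduct (regularPolygon m) =
      ENNReal.ofReal ((m * Real.sin (Real.pi / m)) ^ 2) := by
  have h := convexPolygon_regularVertex hm
  rw [regularPolygon_eq h.pos]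
  refine le_antisymm (h.volumeProduct_le le_rfl) (le_iInf₂ fun z hz => ?_)
  have hz' := h.edgeArea_pos_of_mem_interior hz
  refine (ENNReal.ofReal_le_ofReal (le_polarDoubleArea_regularVertex hm hz')).trans ?_
  rw [ENNReal.ofReal_mul (half_pos h.doubleArea_pos).le]
  exact mul_le_mul' (h.le_volume_hull hz') (h.le_volume_polar hz')

end VolumeProduct

theorem theorem4p1 (m : ℕ) (hm : 3 ≤ m) :
    VolumeProduct.volumeProduct (VolumeProduct.regularPolygon m) =
      ENNReal.ofReal (((m : ℝ) * Real.sin (Real.pi / (m : ℝ))) ^ 2) ∧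
    ∀ K : Set (EuclideanSpace ℝ (Fin 2)), VolumeProduct.IsPolytopeWithAtMost m K →
      VolumeProduct.volumeProduct K ≤
        VolumeProduct.volumeProduct (VolumeProduct.regularPolygon m) ∧
      (VolumeProduct.volumeProduct K =
          VolumeProduct.volumeProduct (VolumeProduct.regularPolygon m) ↔
        ∃ A : EuclideanSpace ℝ (Fin 2) ≃ᵃ[ℝ] EuclideanSpace ℝ (Fin 2),
          K = A '' VolumeProduct.regularPolygon m) := by
  have hreg := VolumeProduct.volumeProduct_regularPolygon hm
  refine ⟨hreg, fun K hK => ?_⟩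
  obtain ⟨n, p, hnm, h, rfl⟩ := hK.exists_convexPolygon
  refine ⟨hreg ▸ h.volumeProduct_le hnm, fun heq => ?_, ?_⟩
  · exact h.exists_affineEquiv_of_volumeProduct_eq hnm (heq.trans hreg)
  · rintro ⟨A, hA⟩
    rw [hA, VolumeProduct.volumeProduct_affine_image]
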